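/- For $n\ge1$, $t>0$ and $u\in L^\infty(\mathbb R^n)$ (real-valued) let $e^{t\Delta}u(x)=\int_{\mathbb R^n}G_t(x-z)u(z)\,dz$, where $G_t(x)=(4\pi t)^{-n/2}e^{-|x|^2/(4t)}$. Let $\alpha>0$, let $k$ be any integer with $k\ge\lfloor\alpha/2\rfloor+1$, and set $$\Lambda^\alpha=\Big\{u\in L^\infty(\mathbb R^n):[u]_{\Lambda^\alpha}=\sup_{x\in\mathbb R^n,\,t>0}\big|t^{k-\alpha/2}\partial_t^ke^{t\Delta}u(x)\big|<\infty\Big\},\qquad \|u\|_{\Lambda^\alpha}=\|u\|_{L^\infty}+[u]_{\Lambda^\alpha}.$$ For an integer $m\ge0$ let $C^m(\mathbb R^n)$ be the space of $m$ times continuously differentiable functions with $\|u\|_{C^m}=\sum_{j\le m}\max_{|\gamma|=j}\sup|D^\gamma u|<\infty$. For $0<\beta<1$ let $C^{m,\beta}(\mathbb R^n)$ be the space of $u\in C^m(\mathbb R^n)$ with $\|u\|_{C^{m,\beta}}=\|u\|_{C^m}+\max_{|\gamma|=m}\sup_{x\ne y}\frac{|D^\gamma u(x)-D^\gamma u(y)|}{|x-y|^\beta}<\infty$.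 Let $\Lambda_*^1=\Lambda_*$ be the space of $u\in L^\infty(\mathbb R^n)$ with $[u]_{\Lambda_*}=\sup_{x,\,h\ne0}\frac{|u(x+h)+u(x-h)-2u(x)|}{|h|}<\infty$, with norm $\|u\|_{L^\infty}+[u]_{\Lambda_*}$. For an integer $l\ge2$ let $\Lambda_*^l$ be the space of $u\in C^{l-1}(\mathbb R^n)$ with $D^\gamma u\in\Lambda_*$ for all $|\gamma|=l-1$, with norm $\|u\|_{C^{l-1}}+\max_{|\gamma|=l-1}[D^\gamma u]_{\Lambda_*}$. Then $$\Lambda^\alpha=\begin{cases}C^{\lfloor\alpha\rfloor,\,\alpha-\lfloor\alpha\rfloor}(\mathbb R^n)&\text{if }\alpha\text{ is not an integer},\\ \Lambda_*^l&\text{if }\alpha=l\text{ is an integer},\end{cases}$$ with equivalent norms; the constants in the equivalence depend only on $n$, $\alpha$ and $k$. Here equality means that every function of the space on the right is essentially bounded and its class modulo almost everywhere equality lies in $\Lambda^\alpha$, and that every class in $\Lambda^\alpha$ has exactly one representative in the space on the right. -/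

import Mathlib

open MeasureTheory
open scoped ENNReal NNReal

noncomputable section

namespace HeatHolder

/-- The space `ℝⁿ` with its Euclidean norm. -/
abbrev E (n : ℕ) : Type := EuclideanSpace ℝ (Fin n)

/-- The Lebesgue space `L^∞(ℝⁿ)` of real functions (classes modulo a.e. equality). -/
abbrev LInfty (n : ℕ) : Type := Lp ℝ ∞ (volume : Measure (E n))

/-! ### The heat semigroup and the space `Λ^α` -/

/-- The Gauss--Weierstrass kernel `G_t(x) = (4πt)^{-n/2} e^{-|x|²/(4t)}`. -/
def heatKernel (n : ℕ) (t : ℝ) (x : E n) : ℝ :=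
  1 / (4 * Real.pi * t) ^ ((n : ℝ) / 2) * Real.exp (-(‖x‖ ^ 2) / (4 * t))

/-- `e^{tΔ}u(x) = ∫ G_t(x - z) u(z) dz` (used for `t > 0` only). -/
def heatSemigroup {n : ℕ} (t : ℝ) (u : E n → ℝ) (x : E n) : ℝ :=
  ∫ z, heatKernel n t (x - z) * u z

/-- `[u]_{Λ^α} = sup_{x, t > 0} |t^{k - α/2} ∂_t^k e^{tΔ}u(x)|`, as an extended number. -/
def heatSeminorm {n : ℕ} (α : ℝ) (k : ℕ) (u : E n → ℝ) : ℝ≥0∞ :=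
  ⨆ (x : E n) (t : ℝ) (_ : 0 < t),
    ‖t ^ ((k : ℝ) - α / 2) * iteratedDeriv k (fun s : ℝ => heatSemigroup s u x) t‖ₑ

/-- The space `Λ^α`, defined with the order `k` of differentiation in time. -/
def heatSpace (n : ℕ) (α : ℝ) (k : ℕ) : Set (LInfty n) :=
  {u | heatSeminorm α k u < ∞}

/-- `‖u‖_{Λ^α} = ‖u‖_{L^∞} + [u]_{Λ^α}`. -/
def heatNorm {n : ℕ} (α : ℝ) (k : ℕ) (u : LInfty n) : ℝ≥0∞ :=
  eLpNorm u ∞ volume + heatSeminorm α k u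

/-! ### Partial derivatives and the spaces `C^m` and `C^{m,β}` -/

/-- The partial derivative `∂_{i_1} ⋯ ∂_{i_j} v(x)` of order `j`. For `v` of class `C^j` these are
the derivatives `D^γ v` with `|γ| = j`: the multi-index `γ` counts how often each coordinate
occurs in the list `i`. -/
def partialDeriv {n j : ℕ} (i : Fin j → Fin n) (v : E n → ℝ) (x : E n) : ℝ :=
  iteratedFDeriv ℝ j v x (fun l => EuclideanSpace.single (i l) (1 : ℝ))

/-- `‖v‖_{C^m} = ∑_{j ≤ m} max_{|γ| = j} sup_x |D^γ v(x)|`. -/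
def cNorm {n : ℕ} (m : ℕ) (v : E n → ℝ) : ℝ≥0∞ :=
  ∑ j ∈ Finset.range (m + 1), ⨆ (i : Fin j → Fin n) (x : E n), ‖partialDeriv i v x‖ₑ

/-- `‖v‖_{C^{m,β}} = ‖v‖_{C^m} + max_{|γ| = m} [D^γ v]_β`, where `[w]_β` is the least `C` with
`|w(x) - w(y)| ≤ C |x - y|^β`. -/
def holderNorm {n : ℕ} (m : ℕ) (β : ℝ≥0) (v : E n → ℝ) : ℝ≥0∞ :=
  cNorm m v + ⨆ i : Fin m → Fin n, eHolderNorm β (partialDeriv i v)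

/-- The Hölder space `C^{m,β}(ℝⁿ)`. -/
def holderSpace (n m : ℕ) (β : ℝ≥0) : Set (E n → ℝ) :=
  {v | ContDiff ℝ m v ∧ holderNorm m β v < ∞}

/-! ### The Zygmund spaces -/

/-- `[v]_{Λ_*} = sup_{x, h} |v(x + h) + v(x - h) - 2 v(x)| / |h|`. -/
def zygmundSeminorm {n : ℕ} (v : E n → ℝ) : ℝ≥0∞ :=
  ⨆ (x : E n) (h : E n) (_ : h ≠ 0), ‖v (x + h) + v (x - h) - 2 * v x‖ₑ / ‖h‖ₑ

/-- The Zygmund space `Λ_* = Λ_*^1`. -/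
def zygmundOne (n : ℕ) : Set (E n → ℝ) :=
  {v | MemLp v ∞ volume ∧ zygmundSeminorm v < ∞}

/-- The Zygmund space `Λ_*^k`; it is used for `k ≥ 1` only. For `k ≥ 2` it consists of the
functions in `C^{k-1}(ℝⁿ)` (all derivatives of order at most `k - 1` are continuous and bounded)
whose derivatives of order `k - 1` lie in `Λ_*`. -/
def zygmundSpace (n k : ℕ) : Set (E n → ℝ) :=
  if k ≤ 1 then zygmundOne n
  else {v | ContDiff ℝ (k - 1 : ℕ) v ∧ cNorm (k - 1) v < ∞ ∧
    ∀ i : Fin (k - 1) → Fin n, partialDeriv i v ∈ zygmundOne n}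

/-- The norm of `Λ_*^k`: `‖v‖_{L^∞} + [v]_{Λ_*}` for `k = 1` and
`‖v‖_{C^{k-1}} + max_{|γ| = k - 1} [D^γ v]_{Λ_*}` for `k ≥ 2`. -/
def zygmundNorm {n : ℕ} (k : ℕ) (v : E n → ℝ) : ℝ≥0∞ :=
  if k ≤ 1 then eLpNorm v ∞ volume + zygmundSeminorm v
  else cNorm (k - 1) v + ⨆ i : Fin (k - 1) → Fin n, zygmundSeminorm (partialDeriv i v)

/-! ### Coincidence of spaces -/

/-- A space `A` of classes in `L^∞`, with norm `NA`, coincides with the space `S` of functions, with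
norm `NS`, with equivalent norms: every function of `S` is essentially bounded with class in `A`,
every class in `A` has exactly one representative in `S`, and the two norms are comparable. -/
def CoincideWithEquivalentNorms {n : ℕ} (A : Set (LInfty n)) (NA : LInfty n → ℝ≥0∞)
    (S : Set (E n → ℝ)) (NS : (E n → ℝ) → ℝ≥0∞) : Prop :=
  (∀ v ∈ S, ∃ hv : MemLp v ∞ volume, hv.toLp v ∈ A) ∧
  (∀ u ∈ A, ∃! v : E n → ℝ, v ∈ S ∧ u =ᵐ[volume] v) ∧
  ∃ c C : ℝ≥0, 0 < c ∧ 0 < C ∧ ∀ u ∈ A, ∀ v ∈ S, u =ᵐ[volume] v →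
    c * NS v ≤ NA u ∧ NA u ≤ C * NS v

end HeatHolder

end

noncomputable section

namespace HeatHolder

open Filter Topology

variable {n : ℕ}

/-! ### The heat kernel -/

/-! The seminorm says that `∂_t^k e^{tΔ}u` is `O(t^{α/2-k})`; this is `HeatBound`. A time derivative
costs a factor `t⁻¹` and a space derivative a factor `t^{-1/2}`, so time decay measures smoothness
in space. Each such cost is obtained by writing `e^{tΔ} = e^{(t/2)Δ} e^{(t/2)Δ}`, putting the new
derivative on the kernel of one half and the known bound on the other. The order `k` does not matter
as long as `k > α/2` (`HeatBound.change`): going up costs `t⁻¹`, going down is integration from `t`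
to `∞`, where the time derivatives vanish because `u` is bounded. For `0 < β ≤ 1`, decay makes
`e^{tΔ}u` converge uniformly to a continuous `v` at rate `t^{β/2}`, while its second differences are
`O(|h|² t^{β/2-1})` and, if `β < 1`, its first differences are `O(|h| t^{β/2-1/2})`. Taking `t =
|h|²` gives the regularity of `v` (`HeatBound.exists_zygmund`). The first-difference bound breaks
down at `β = 1`, which is why Zygmund spaces appear at integers. Conversely `∂_t G_t` is even with
integral zero, so `2 ∂_t e^{tΔ}v(x)` is the integral of `∂_t G_t` against second differences of `v`
(`ZygmundBound.heatBound`). Larger exponents reduce to this case by induction. Decay of order `α >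
1` yields a `C¹` representative whose partial derivatives decay with order `α - 1`
(`HeatBound.exists_contDiff_one`). The converse (`HeatBound.of_fderiv`) is the heat equation `∂_t
e^{tΔ}f = ∑ ∂_i G_t * ∂_i f`. Finally `coincide_of_bounds` turns the two quantitative implications
and uniqueness of representatives into equality of spaces with equivalent norms. -/

lemma heatKernel_pos {t : ℝ} (ht : 0 < t) (z : E n) : 0 < heatKernel n t z := by
  unfold heatKernel
  positivity

lemma heatKernel_neg (t : ℝ) (z : E n) : heatKernel n t (-z) = heatKernel n t z := by
  simp [heatKernel]

lemma continuous_heatKernel (t : ℝ) : Continuous (heatKernel n t) := by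
  unfold heatKernel
  fun_prop

lemma integrable_exp_neg_mul_sq_norm {b : ℝ} (hb : 0 < b) :
    Integrable (fun z : E n => Real.exp (-b * ‖z‖ ^ 2)) := by
  have h := (GaussianFourier.integrable_cexp_neg_mul_sq_norm_add (V := E n) (b := (b : ℂ))
    (by simpa using hb) 0 0).norm
  refine h.congr (ae_of_all _ fun z => ?_)
  simp only [zero_mul, add_zero, Complex.norm_exp]
  congr 1
  norm_cast

lemma integral_exp_neg_mul_sq_norm {b : ℝ} (hb : 0 < b) :
    ∫ z : E n, Real.exp (-b * ‖z‖ ^ 2) = (Real.pi / b) ^ ((n : ℝ) / 2) := by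
  have h := GaussianFourier.integral_rexp_neg_mul_sq_norm (V := E n) hb
  rwa [finrank_euclideanSpace_fin] at h

lemma heatKernel_eq (t : ℝ) (z : E n) : heatKernel n t z =
    1 / (4 * Real.pi * t) ^ ((n : ℝ) / 2) * Real.exp (-(1 / (4 * t)) * ‖z‖ ^ 2) := by
  unfold heatKernel
  congr 2
  ring

lemma integrable_heatKernel {t : ℝ} (ht : 0 < t) : Integrable (heatKernel n t) := by
  have h := (integrable_exp_neg_mul_sq_norm (n := n) (b := 1 / (4 * t)) (by positivity)).const_mul
    (1 / (4 * Real.pi * t) ^ ((n : ℝ) / 2))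
  exact h.congr (ae_of_all _ fun z => (heatKernel_eq t z).symm)

lemma integral_heatKernel {t : ℝ} (ht : 0 < t) : ∫ z, heatKernel n t z = 1 := by
  simp_rw [heatKernel_eq]
  rw [integral_const_mul, integral_exp_neg_mul_sq_norm (by positivity)]
  have : Real.pi / (1 / (4 * t)) = 4 * Real.pi * t := by field_simp
  rw [this, one_div, inv_mul_cancel₀]
  positivity

/-- The semigroup law at the level of kernels. -/
lemma integral_heatKernel_mul {s t : ℝ} (hs : 0 < s) (ht : 0 < t) (x : E n) :
    ∫ z, heatKernel n s z * heatKernel n t (x - z) = heatKernel n (s + t) x := by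
  -- Completing the square: the product of the two Gaussians in `z` is a Gaussian of time `s t / (s
  -- + t)` centred at `(s / (s + t)) x`, with total mass `G_{s+t}(x)`.
  have key : ∀ z : E n, heatKernel n s z * heatKernel n t (x - z) =
      heatKernel n (s + t) x * heatKernel n (s * t / (s + t)) (z - (s / (s + t)) • x) := by
    intro z
    have h1 : ‖x - z‖ ^ 2 = ‖x‖ ^ 2 - 2 * inner ℝ x z + ‖z‖ ^ 2 := norm_sub_sq_real x z
    have h2 : ‖z - (s / (s + t)) • x‖ ^ 2 =
        ‖z‖ ^ 2 - 2 * (s / (s + t) * inner ℝ x z) + (s / (s + t)) ^ 2 * ‖x‖ ^ 2 := by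
      rw [norm_sub_sq_real, inner_smul_right, real_inner_comm, norm_smul, mul_pow, Real.norm_eq_abs,
        sq_abs]
    simp only [heatKernel]
    rw [h1, h2, mul_mul_mul_comm, ← Real.exp_add, mul_mul_mul_comm, ← Real.exp_add]
    have hst : 0 < s + t := by positivity
    congr 1
    · rw [one_div_mul_one_div, one_div_mul_one_div, ← Real.mul_rpow (by positivity) (by positivity),
        ← Real.mul_rpow (by positivity) (by positivity)]
      congr 2
      field_simp
    · congr 1
      field_simp
      ring
  simp_rw [key]
  rw [integral_const_mul, integral_sub_right_eq_self (heatKernel n (s * t / (s + t))),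
    integral_heatKernel (by positivity), mul_one]

/-- Enlarging the time costs only a constant. This supplies a single integrable majorant for kernels
whose times range over a bounded interval away from `0`. -/
lemma heatKernel_le_mul {s t c : ℝ} (hs : 0 < s) (hst : s ≤ t) (htc : t ≤ c * s) (z : E n) :
    heatKernel n s z ≤ c ^ ((n : ℝ) / 2) * heatKernel n t z := by
  have ht : 0 < t := hs.trans_le hst
  have hc : 0 < c := by
    by_contra h
    nlinarith
  unfold heatKernel
  rw [← mul_assoc]
  gcongr ?_ * ?_
  · rw [mul_one_div, div_le_div_iff₀ (by positivity) (by positivity), one_mul,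
      ← Real.mul_rpow hc.le (by positivity)]
    refine Real.rpow_le_rpow (by positivity) ?_ (by positivity)
    nlinarith [Real.pi_pos]
  · refine Real.exp_le_exp.2 ?_
    rw [neg_div, neg_div, neg_le_neg_iff]
    gcongr

/-- The constant `2^{n/2}`. -/
def kc (n : ℕ) : ℝ := (2 : ℝ) ^ ((n : ℝ) / 2)

lemma kc_pos (n : ℕ) : 0 < kc n := by
  unfold kc
  positivity

lemma heatKernel_le_two {t : ℝ} (ht : 0 < t) (z : E n) :
    heatKernel n t z ≤ kc n * heatKernel n (2 * t) z :=
  heatKernel_le_mul ht (by linarith) le_rfl z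

lemma kc_mul_coeff {t : ℝ} (ht : 0 < t) :
    kc n * (1 / (4 * Real.pi * (2 * t)) ^ ((n : ℝ) / 2)) = 1 / (4 * Real.pi * t) ^ ((n : ℝ) / 2) := by
  have : 4 * Real.pi * (2 * t) = 2 * (4 * Real.pi * t) := by ring
  rw [this, Real.mul_rpow zero_le_two (by positivity), kc]
  field_simp

/-- Doubling the time absorbs polynomial factors: `G_t` is `2^{n/2} G_{2t}` times `e^{-r/8}` with `r
= |z|²/t`, and `r e^{-r/8} ≤ 8`. -/
lemma sq_norm_mul_heatKernel_le {t : ℝ} (ht : 0 < t) (z : E n) :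
    ‖z‖ ^ 2 / t * heatKernel n t z ≤ 8 * kc n * heatKernel n (2 * t) z := by
  have h1 : heatKernel n t z =
      kc n * heatKernel n (2 * t) z * Real.exp (-(‖z‖ ^ 2 / t / 8)) := by
    unfold heatKernel
    rw [← kc_mul_coeff ht, mul_assoc (kc n), mul_assoc (kc n), mul_assoc (1 / _), ← Real.exp_add]
    congr 3
    field_simp
    ring
  rw [h1]
  set r := ‖z‖ ^ 2 / t with hr
  have hk := mul_pos (kc_pos n) (heatKernel_pos (n := n) (t := 2 * t) (by positivity) z)
  have h2 : r * Real.exp (-(r / 8)) ≤ 8 := by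
    have h3 := Real.add_one_le_exp (r / 8)
    rw [Real.exp_neg, ← div_eq_mul_inv, div_le_iff₀ (Real.exp_pos _)]
    linarith
  calc r * (kc n * heatKernel n (2 * t) z * Real.exp (-(r / 8)))
      = (r * Real.exp (-(r / 8))) * (kc n * heatKernel n (2 * t) z) := by ring
    _ ≤ 8 * (kc n * heatKernel n (2 * t) z) := by gcongr
    _ = _ := by ring

/-! ### Derivatives of the heat kernel -/

/-- The time derivative `∂_t G_t(z)`. -/
def timeKernel (n : ℕ) (t : ℝ) (z : E n) : ℝ :=
  (‖z‖ ^ 2 / (4 * t ^ 2) - n / (2 * t)) * heatKernel n t z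

/-- The directional derivative `∂_e G_t(z)`. -/
def gradKernel (n : ℕ) (t : ℝ) (e z : E n) : ℝ :=
  -(inner ℝ z e / (2 * t)) * heatKernel n t z

lemma continuous_timeKernel (t : ℝ) : Continuous (timeKernel n t) := by
  unfold timeKernel
  have := continuous_heatKernel (n := n) t
  fun_prop

lemma continuous_gradKernel (t : ℝ) (e : E n) : Continuous (gradKernel n t e) := by
  unfold gradKernel
  have := continuous_heatKernel (n := n) t
  fun_prop

lemma hasDerivAt_heatKernel {t : ℝ} (ht : 0 < t) (z : E n) :
    HasDerivAt (fun s => heatKernel n s z) (timeKernel n t z) t := by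
  unfold heatKernel
  have h1 : HasDerivAt (fun s : ℝ => 4 * Real.pi * s) (4 * Real.pi) t := by
    simpa using (hasDerivAt_id t).const_mul (4 * Real.pi)
  have h2 := h1.rpow_const (p := -((n : ℝ) / 2)) (Or.inl (by positivity))
  have h3 : HasDerivAt (fun s : ℝ => -(‖z‖ ^ 2) / (4 * s)) (‖z‖ ^ 2 / (4 * t ^ 2)) t := by
    have := ((hasDerivAt_id t).const_mul 4).inv (by simpa using ht.ne')
    convert! (this.const_mul (-(‖z‖ ^ 2))) using 1
    simp
    field_simp
  have h4 := h2.mul h3.exp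
  have h5 : (fun s : ℝ => 1 / (4 * Real.pi * s) ^ ((n : ℝ) / 2) *
      Real.exp (-(‖z‖ ^ 2) / (4 * s))) =ᶠ[𝓝 t]
      (fun s => (4 * Real.pi * s) ^ (-((n : ℝ) / 2))) * fun s => Real.exp (-(‖z‖ ^ 2) / (4 * s)) := by
    filter_upwards [lt_mem_nhds ht] with s hs
    rw [one_div, ← Real.rpow_neg (by positivity), Pi.mul_apply]
  convert! h4.congr_of_eventuallyEq h5 using 1
  rw [timeKernel, heatKernel, Real.rpow_sub_one (by positivity), Real.rpow_neg (by positivity)]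
  field_simp
  ring

/-- A constant bounding `t |∂_t G_t| / G_{2t}`. -/
def timeC (n : ℕ) : ℝ := kc n * (2 + n)

lemma timeC_nonneg (n : ℕ) : 0 ≤ timeC n := by
  have := kc_pos n
  unfold timeC
  positivity

lemma abs_timeKernel_le {t : ℝ} (ht : 0 < t) (z : E n) :
    |timeKernel n t z| ≤ timeC n / t * heatKernel n (2 * t) z := by
  have h1 := sq_norm_mul_heatKernel_le ht z
  have h2 := heatKernel_le_two ht z
  have h0 := (heatKernel_pos ht z).le
  have h0' := (heatKernel_pos (n := n) (t := 2 * t) (by positivity) z).le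
  have hk := (kc_pos n).le
  rw [timeKernel, abs_mul, abs_of_nonneg h0]
  have h3 : |‖z‖ ^ 2 / (4 * t ^ 2) - n / (2 * t)| ≤ ‖z‖ ^ 2 / (4 * t ^ 2) + n / (2 * t) := by
    refine (abs_sub _ _).trans_eq ?_
    rw [abs_of_nonneg (by positivity), abs_of_nonneg (by positivity)]
  calc _ ≤ (‖z‖ ^ 2 / (4 * t ^ 2) + n / (2 * t)) * heatKernel n t z := by gcongr
    _ = 1 / t * (1 / 4 * (‖z‖ ^ 2 / t * heatKernel n t z) + n / 2 * heatKernel n t z) := by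
      field_simp
    _ ≤ 1 / t * (1 / 4 * (8 * kc n * heatKernel n (2 * t) z) +
        n * (kc n * heatKernel n (2 * t) z)) := by
      gcongr
      linarith [n.cast_nonneg (α := ℝ)]
    _ = _ := by rw [timeC]; ring

lemma norm_mul_heatKernel_le {t : ℝ} (ht : 0 < t) (z : E n) :
    ‖z‖ / Real.sqrt t * heatKernel n t z ≤ 9 * kc n * heatKernel n (2 * t) z := by
  have h1 := sq_norm_mul_heatKernel_le ht z
  have h2 := heatKernel_le_two ht z
  have h0 := (heatKernel_pos ht z).le
  have h3 : ‖z‖ / Real.sqrt t ≤ 1 + ‖z‖ ^ 2 / t := by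
    have : ‖z‖ ^ 2 / t = (‖z‖ / Real.sqrt t) ^ 2 := by rw [div_pow, Real.sq_sqrt ht.le]
    rw [this]
    nlinarith [sq_nonneg (‖z‖ / Real.sqrt t - 1)]
  calc _ ≤ (1 + ‖z‖ ^ 2 / t) * heatKernel n t z := by gcongr
    _ = heatKernel n t z + ‖z‖ ^ 2 / t * heatKernel n t z := by ring
    _ ≤ _ := by linarith

/-- A constant bounding `√t |∂_e G_t| / G_{2t}`. -/
def gradC (n : ℕ) : ℝ := 5 * kc n

lemma gradC_nonneg (n : ℕ) : 0 ≤ gradC n := by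
  have := kc_pos n
  unfold gradC
  positivity

lemma abs_gradKernel_le {t : ℝ} (ht : 0 < t) (e z : E n) :
    |gradKernel n t e z| ≤ gradC n / Real.sqrt t * ‖e‖ * heatKernel n (2 * t) z := by
  have h1 := norm_mul_heatKernel_le ht z
  have h0 := (heatKernel_pos ht z).le
  have h0' := (heatKernel_pos (n := n) (t := 2 * t) (by positivity) z).le
  have hk := (kc_pos n).le
  have hs : 0 < Real.sqrt t := Real.sqrt_pos.2 ht
  rw [gradKernel, abs_mul, abs_of_nonneg h0, abs_neg, abs_div, abs_of_pos (by positivity : 0 < 2 * t)]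
  calc _ ≤ ‖z‖ * ‖e‖ / (2 * t) * heatKernel n t z := by
        gcongr
        exact abs_real_inner_le_norm z e
    _ = ‖e‖ / (2 * Real.sqrt t) * (‖z‖ / Real.sqrt t * heatKernel n t z) := by
      have : t = Real.sqrt t * Real.sqrt t := (Real.mul_self_sqrt ht.le).symm
      rw [show 2 * t = 2 * (Real.sqrt t * Real.sqrt t) by rw [← this]]
      field_simp
    _ ≤ ‖e‖ / (2 * Real.sqrt t) * (10 * kc n * heatKernel n (2 * t) z) := by
      refine mul_le_mul_of_nonneg_left (h1.trans ?_) (by positivity)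
      gcongr
      norm_num
    _ = _ := by rw [gradC]; field_simp; ring

lemma integrable_timeKernel {t : ℝ} (ht : 0 < t) : Integrable (timeKernel n t) :=
  ((integrable_heatKernel (t := 2 * t) (by positivity)).const_mul (timeC n / t)).mono'
    (continuous_timeKernel t).aestronglyMeasurable (ae_of_all _ (abs_timeKernel_le ht))

lemma integrable_gradKernel {t : ℝ} (ht : 0 < t) (e : E n) : Integrable (gradKernel n t e) :=
  ((integrable_heatKernel (t := 2 * t) (by positivity)).const_mul
    (gradC n / Real.sqrt t * ‖e‖)).mono'
    (continuous_gradKernel t e).aestronglyMeasurable (ae_of_all _ (abs_gradKernel_le ht e))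

lemma integral_abs_timeKernel_le {t : ℝ} (ht : 0 < t) :
    ∫ z, |timeKernel n t z| ≤ timeC n / t := by
  refine (integral_mono_of_nonneg (ae_of_all _ fun _ => abs_nonneg _)
    ((integrable_heatKernel (t := 2 * t) (by positivity)).const_mul (timeC n / t))
    (ae_of_all _ (abs_timeKernel_le ht))).trans_eq ?_
  rw [integral_const_mul, integral_heatKernel (by positivity), mul_one]

lemma integral_abs_gradKernel_le {t : ℝ} (ht : 0 < t) (e : E n) :
    ∫ z, |gradKernel n t e z| ≤ gradC n / Real.sqrt t * ‖e‖ := by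
  refine (integral_mono_of_nonneg (ae_of_all _ fun _ => abs_nonneg _)
    ((integrable_heatKernel (t := 2 * t) (by positivity)).const_mul
      (gradC n / Real.sqrt t * ‖e‖)) (ae_of_all _ (abs_gradKernel_le ht e))).trans_eq ?_
  rw [integral_const_mul, integral_heatKernel (by positivity), mul_one]

lemma integral_abs_heatKernel {t : ℝ} (ht : 0 < t) : ∫ z, |heatKernel n t z| = 1 := by
  simp_rw [fun z : E n => abs_of_pos (heatKernel_pos ht z)]
  exact integral_heatKernel ht

/-! ### Convolution of integrable kernels with bounded functions -/

/-- Essentially bounded functions, with a bound. -/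
structure BM (u : E n → ℝ) (M : ℝ) : Prop where
  aesm : AEStronglyMeasurable u volume
  bd : ∀ᵐ x, |u x| ≤ M

/-- The convolution `∫ K(z) u(x - z) dz`. -/
def conv (K u : E n → ℝ) (x : E n) : ℝ := ∫ z, K z * u (x - z)

lemma BM.of_le {u : E n → ℝ} {M : ℝ} (hu : AEStronglyMeasurable u volume) (h : ∀ x, |u x| ≤ M) :
    BM u M := ⟨hu, ae_of_all _ h⟩

lemma BM.nonneg {u : E n → ℝ} {M : ℝ} (hu : BM u M) : 0 ≤ M := by
  obtain ⟨x, hx⟩ := hu.bd.exists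
  exact (abs_nonneg _).trans hx

lemma BM.mono {u : E n → ℝ} {M N : ℝ} (hu : BM u M) (h : M ≤ N) : BM u N :=
  ⟨hu.aesm, hu.bd.mono fun _ hx => hx.trans h⟩

lemma BM.norm {u : E n → ℝ} {M : ℝ} (hu : BM u M) : BM (fun z => ‖u z‖) M :=
  ⟨hu.aesm.norm, by simpa using hu.bd⟩

lemma BM.comp_sub_left {u : E n → ℝ} {M : ℝ} (hu : BM u M) (x : E n) :
    BM (fun z => u (x - z)) M :=
  ⟨hu.aesm.comp_quasiMeasurePreserving (quasiMeasurePreserving_sub_left volume x),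
    (quasiMeasurePreserving_sub_left volume x).ae hu.bd⟩

lemma BM.integrable_mul {K u : E n → ℝ} {M : ℝ} (hK : Integrable K) (hu : BM u M) :
    Integrable (fun z => K z * u z) := by
  refine (hK.norm.mul_const M).mono' (hK.aestronglyMeasurable.mul hu.aesm) ?_
  filter_upwards [hu.bd] with z hz
  rw [norm_mul]
  gcongr
  exact hz

lemma BM.abs_conv_le {K u : E n → ℝ} {M : ℝ} (hK : Integrable K) (hu : BM u M) (x : E n) :
    |conv K u x| ≤ (∫ z, |K z|) * M := by
  rw [← integral_mul_const]
  refine norm_integral_le_of_norm_le (f := fun z => K z * u (x - z)) (hK.norm.mul_const M) ?_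
  filter_upwards [(hu.comp_sub_left x).bd] with z hz
  rw [norm_mul]
  exact mul_le_mul_of_nonneg_left hz (abs_nonneg _)

lemma aesm_conv {K u : E n → ℝ} (hK : Integrable K) (hu : AEStronglyMeasurable u volume) :
    AEStronglyMeasurable (conv K u) volume :=
  (AEStronglyMeasurable.convolution_integrand (ContinuousLinearMap.mul ℝ ℝ)
    hK.aestronglyMeasurable hu).integral_prod_right'

lemma BM.conv {K u : E n → ℝ} {M : ℝ} (hK : Integrable K) (hu : BM u M) :
    BM (conv K u) ((∫ z, |K z|) * M) :=
  .of_le (aesm_conv hK hu.aesm) (hu.abs_conv_le hK)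

lemma conv_congr_ae {K u v : E n → ℝ} (h : u =ᵐ[volume] v) : conv K u = conv K v := by
  funext x
  refine integral_congr_ae ?_
  filter_upwards [(quasiMeasurePreserving_sub_left volume x).ae_eq h] with z hz
  simp only [Function.comp_apply] at hz
  rw [hz]

lemma conv_eq_integral_sub (K u : E n → ℝ) (x : E n) : conv K u x = ∫ z, K (x - z) * u z := by
  rw [conv, ← integral_sub_left_eq_self _ volume x]
  simp

lemma conv_conv {K L u : E n → ℝ} {M : ℝ} (hK : Integrable K) (hL : Integrable L) (hu : BM u M)
    (x : E n) : conv K (conv L u) x = conv (conv K L) u x := by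
  have h1 : ∀ y, HeatHolder.conv L u (x - y) = ∫ z, L (z - y) * u (x - z) := by
    intro y
    rw [HeatHolder.conv, ← integral_sub_right_eq_self _ y]
    simp
  have h2 : ∀ z, HeatHolder.conv K L z * u (x - z) = ∫ y, K y * (L (z - y) * u (x - z)) := by
    intro z
    rw [HeatHolder.conv, ← integral_mul_const]
    simp_rw [mul_assoc]
  rw [HeatHolder.conv, HeatHolder.conv]
  simp_rw [h1, h2, ← integral_const_mul]
  rw [integral_integral_swap]
  have h3 : Integrable (fun p : E n × E n => K p.2 * L (p.1 - p.2)) (volume.prod volume) :=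
    hK.convolution_integrand (ContinuousLinearMap.mul ℝ ℝ) hL
  have h4 : AEStronglyMeasurable (fun p : E n × E n => u (x - p.1)) (volume.prod volume) :=
    (hu.comp_sub_left x).aesm.comp_quasiMeasurePreserving
      Measure.quasiMeasurePreserving_fst
  have h5 : ∀ᵐ p : E n × E n ∂(volume.prod volume), |u (x - p.1)| ≤ M :=
    Measure.quasiMeasurePreserving_fst.ae (hu.comp_sub_left x).bd
  have h6 : Integrable (fun p : E n × E n => K p.2 * L (p.1 - p.2) * u (x - p.1))
      (volume.prod volume) := by
    refine (h3.norm.mul_const M).mono' (h3.aestronglyMeasurable.mul h4) ?_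
    filter_upwards [h5] with p hp
    rw [norm_mul]
    gcongr
    exact hp
  refine (h6.swap).congr (ae_of_all _ fun p => ?_)
  simp [Function.uncurry, mul_assoc]

/-- Differentiation of a parameter under a convolution. -/
lemma hasDerivAt_conv {K : E n → ℝ} (hK : Integrable K) {w w' : ℝ → E n → ℝ} {t B : ℝ}
    {s : Set ℝ} (hs : s ∈ 𝓝 t) (hw : ∀ r ∈ s, AEStronglyMeasurable (w r) volume) {M : ℝ}
    (hwt : BM (w t) M) (hw' : AEStronglyMeasurable (w' t) volume)
    (hB : ∀ r ∈ s, ∀ x, |w' r x| ≤ B) (hd : ∀ r ∈ s, ∀ x, HasDerivAt (fun r => w r x) (w' r x) r)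
    (x : E n) : HasDerivAt (fun r => conv K (w r) x) (conv K (w' t) x) t := by
  refine (hasDerivAt_integral_of_dominated_loc_of_deriv_le (bound := fun z => ‖K z‖ * B) hs ?_
    (BM.integrable_mul hK (hwt.comp_sub_left x)) (F' := fun r z => K z * w' r (x - z))
    ?_ ?_ (hK.norm.mul_const B) ?_).2
  · filter_upwards [hs] with r hr
    exact hK.aestronglyMeasurable.mul
      ((hw r hr).comp_quasiMeasurePreserving (quasiMeasurePreserving_sub_left volume x))
  · exact hK.aestronglyMeasurable.mul
      (hw'.comp_quasiMeasurePreserving (quasiMeasurePreserving_sub_left volume x))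
  · refine ae_of_all _ fun z r hr => ?_
    rw [norm_mul]
    gcongr
    exact hB r hr _
  · exact ae_of_all _ fun z r hr => (hd r hr (x - z)).const_mul (K z)

/-! ### The heat semigroup -/

lemma heatSemigroup_eq_conv (t : ℝ) (u : E n → ℝ) :
    heatSemigroup t u = conv (heatKernel n t) u := by
  funext x
  rw [conv_eq_integral_sub]
  rfl

lemma BM.abs_heatSemigroup_le {u : E n → ℝ} {M t : ℝ} (hu : BM u M) (ht : 0 < t) (x : E n) :
    |heatSemigroup t u x| ≤ M := by
  have := hu.abs_conv_le (integrable_heatKernel ht) x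
  rwa [integral_abs_heatKernel ht, one_mul, ← heatSemigroup_eq_conv] at this

lemma BM.heatSemigroup {u : E n → ℝ} {M t : ℝ} (hu : BM u M) (ht : 0 < t) :
    BM (heatSemigroup t u) M := by
  refine .of_le ?_ (hu.abs_heatSemigroup_le ht)
  rw [heatSemigroup_eq_conv]
  exact aesm_conv (integrable_heatKernel ht) hu.aesm

lemma BM.heatSemigroup_add {u : E n → ℝ} {M s t : ℝ} (hu : BM u M) (hs : 0 < s) (ht : 0 < t)
    (x : E n) : HeatHolder.heatSemigroup (s + t) u x =
      HeatHolder.heatSemigroup s (HeatHolder.heatSemigroup t u) x := by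
  simp only [heatSemigroup_eq_conv]
  rw [conv_conv (integrable_heatKernel hs) (integrable_heatKernel ht) hu]
  congr 1
  funext z
  exact (integral_heatKernel_mul hs ht z).symm

lemma BM.abs_timeConv_le {u : E n → ℝ} {M t : ℝ} (hu : BM u M) (ht : 0 < t) (x : E n) :
    |HeatHolder.conv (timeKernel n t) u x| ≤ timeC n / t * M :=
  (hu.abs_conv_le (integrable_timeKernel ht) x).trans
    (mul_le_mul_of_nonneg_right (integral_abs_timeKernel_le ht) hu.nonneg)

lemma BM.timeConv {u : E n → ℝ} {M t : ℝ} (hu : BM u M) (ht : 0 < t) :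
    BM (HeatHolder.conv (timeKernel n t) u) (timeC n / t * M) :=
  .of_le (aesm_conv (integrable_timeKernel ht) hu.aesm) (hu.abs_timeConv_le ht)

lemma BM.abs_gradConv_le {u : E n → ℝ} {M t : ℝ} (hu : BM u M) (ht : 0 < t) (e x : E n) :
    |HeatHolder.conv (gradKernel n t e) u x| ≤ gradC n / Real.sqrt t * ‖e‖ * M :=
  (hu.abs_conv_le (integrable_gradKernel ht e) x).trans
    (mul_le_mul_of_nonneg_right (integral_abs_gradKernel_le ht e) hu.nonneg)

lemma BM.hasDerivAt_heatSemigroup {u : E n → ℝ} {M t : ℝ} (hu : BM u M) (ht : 0 < t) (x : E n) :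
    HasDerivAt (fun s => HeatHolder.heatSemigroup s u x)
      (HeatHolder.conv (timeKernel n t) u x) t := by
  simp_rw [heatSemigroup_eq_conv]
  have hs : Set.Ioo (t / 2) (2 * t) ∈ 𝓝 t := Ioo_mem_nhds (by linarith) (by linarith)
  have hv := hu.comp_sub_left x
  -- One majorant for all times `r` in `(t/2, 2t)`: there `G_{2r} ≤ 4^{n/2} G_{4t}` and `1/r ≤
  -- 1/(t/2)`.
  have hG : Integrable fun z : E n => timeC n / (t / 2) * (4 ^ ((n : ℝ) / 2) * heatKernel n (4 * t) z) :=
    ((integrable_heatKernel (by positivity)).const_mul _).const_mul _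
  refine (hasDerivAt_integral_of_dominated_loc_of_deriv_le (bound := fun z =>
    (timeC n / (t / 2) * (4 ^ ((n : ℝ) / 2) * heatKernel n (4 * t) z)) * ‖u (x - z)‖) hs ?_
    (BM.integrable_mul (integrable_heatKernel ht) hv) (F' := fun r z => timeKernel n r z * u (x - z))
    ?_ ?_ (BM.integrable_mul hG hv.norm) ?_).2
  · exact Eventually.of_forall fun r => (continuous_heatKernel r).aestronglyMeasurable.mul hv.aesm
  · exact (continuous_timeKernel t).aestronglyMeasurable.mul hv.aesm
  · refine ae_of_all _ fun z r hr => ?_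
    have hr0 : 0 < r := by linarith [hr.1]
    rw [norm_mul]
    refine mul_le_mul_of_nonneg_right ((abs_timeKernel_le hr0 z).trans ?_) (norm_nonneg _)
    have := timeC_nonneg n
    have := (heatKernel_pos (n := n) (t := 2 * r) (by positivity) z).le
    gcongr
    · exact hr.1.le
    · exact heatKernel_le_mul (by positivity) (by linarith [hr.2]) (by linarith [hr.1]) z
  · refine ae_of_all _ fun z r hr => ?_
    have hr0 : 0 < r := by linarith [hr.1]
    exact (hasDerivAt_heatKernel hr0 z).mul_const _

/-- Both sides are the derivative in `t` of `e^{(s+t)Δ}u = e^{sΔ}e^{tΔ}u`, computed with `s` fixed.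
-/
lemma BM.timeConv_add {u : E n → ℝ} {M s t : ℝ} (hu : BM u M) (hs : 0 < s) (ht : 0 < t)
    (x : E n) : HeatHolder.conv (timeKernel n (s + t)) u x =
      HeatHolder.heatSemigroup s (HeatHolder.conv (timeKernel n t) u) x := by
  have h1 := (hu.hasDerivAt_heatSemigroup (add_pos hs ht) x).comp_const_add s t
  have hS : Set.Ioi (t / 2) ∈ 𝓝 t := Ioi_mem_nhds (by linarith)
  have h2 := hasDerivAt_conv (integrable_heatKernel (n := n) hs)
    (w := fun r => HeatHolder.heatSemigroup r u) (B := timeC n / (t / 2) * M)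
    (w' := fun r => HeatHolder.conv (timeKernel n r) u) hS
    (fun r hr => (hu.heatSemigroup (lt_trans (by positivity) hr)).aesm) (hu.heatSemigroup ht)
    (hu.timeConv ht).aesm (fun r hr y => by
      have hr' : t / 2 < r := hr
      have := timeC_nonneg n
      have := hu.nonneg
      refine (hu.abs_timeConv_le (lt_trans (by positivity) hr) y).trans ?_
      gcongr)
    (fun r hr y => hu.hasDerivAt_heatSemigroup (lt_trans (by positivity) hr) y) x
  have h3 : (fun r => HeatHolder.heatSemigroup (s + r) u x) =ᶠ[𝓝 t]
      fun r => HeatHolder.conv (heatKernel n s) (HeatHolder.heatSemigroup r u) x := by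
    filter_upwards [lt_mem_nhds ht] with r hr
    rw [hu.heatSemigroup_add hs hr, heatSemigroup_eq_conv s]
  rw [heatSemigroup_eq_conv s]
  exact h1.unique (h2.congr_of_eventuallyEq h3)

/-! ### Spatial derivatives of the heat semigroup -/

/-- Majorant uniform over unit translations, needed to differentiate under the integral in `x`. It
rests on `|z|² ≤ 2|z + h|² + 2`. -/
lemma heatKernel_add_le {t : ℝ} (ht : 0 < t) (z : E n) {h : E n} (hh : ‖h‖ ≤ 1) :
    heatKernel n t (z + h) ≤ kc n * Real.exp (1 / (4 * t)) * heatKernel n (2 * t) z := by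
  have hk := kc_pos n
  have h1 : ‖z‖ ≤ ‖z + h‖ + ‖h‖ := by simpa using norm_sub_le (z + h) h
  have h2 : ‖z‖ ^ 2 ≤ 2 * ‖z + h‖ ^ 2 + 2 := by
    nlinarith [norm_nonneg z, norm_nonneg (z + h), norm_nonneg h, sq_nonneg (‖z + h‖ - ‖h‖)]
  have h3 : Real.exp (-(‖z + h‖ ^ 2) / (4 * t)) ≤
      Real.exp (1 / (4 * t)) * Real.exp (-(‖z‖ ^ 2) / (4 * (2 * t))) := by
    rw [← Real.exp_add, Real.exp_le_exp, div_add_div _ _ (by positivity) (by positivity),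
      div_le_div_iff₀ (by positivity) (by positivity)]
    have : 0 < t ^ 3 := by positivity
    nlinarith [mul_pos ht ht]
  calc heatKernel n t (z + h) = kc n * (1 / (4 * Real.pi * (2 * t)) ^ ((n : ℝ) / 2)) *
        Real.exp (-(‖z + h‖ ^ 2) / (4 * t)) := by rw [kc_mul_coeff ht]; rfl
    _ ≤ kc n * (1 / (4 * Real.pi * (2 * t)) ^ ((n : ℝ) / 2)) *
        (Real.exp (1 / (4 * t)) * Real.exp (-(‖z‖ ^ 2) / (4 * (2 * t)))) := by gcongr
    _ = _ := by unfold heatKernel; ring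

/-- The Fréchet derivative of the heat kernel. -/
def heatKernelFDeriv (n : ℕ) (t : ℝ) (z : E n) : E n →L[ℝ] ℝ :=
  (-(1 / (2 * t)) * heatKernel n t z) • innerSL ℝ z

lemma heatKernelFDeriv_apply (t : ℝ) (z e : E n) :
    heatKernelFDeriv n t z e = gradKernel n t e z := by
  simp [heatKernelFDeriv, gradKernel]
  ring

lemma continuous_heatKernelFDeriv (t : ℝ) : Continuous (heatKernelFDeriv n t) := by
  unfold heatKernelFDeriv
  have := continuous_heatKernel (n := n) t
  fun_prop

lemma norm_heatKernelFDeriv_le {t : ℝ} (ht : 0 < t) (z : E n) :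
    ‖heatKernelFDeriv n t z‖ ≤ gradC n / Real.sqrt t * heatKernel n (2 * t) z := by
  have := gradC_nonneg n
  have := (heatKernel_pos (n := n) (t := 2 * t) (by positivity) z).le
  refine ContinuousLinearMap.opNorm_le_bound _ (by positivity) fun e => ?_
  rw [heatKernelFDeriv_apply]
  refine (abs_gradKernel_le ht e z).trans_eq ?_
  ring

lemma hasFDerivAt_heatKernel {t : ℝ} (ht : 0 < t) (z : E n) :
    HasFDerivAt (heatKernel n t) (heatKernelFDeriv n t z) z := by
  have h1 : HasFDerivAt (fun z : E n => ‖z‖ ^ 2) (2 • innerSL ℝ z) z :=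
    (hasStrictFDerivAt_norm_sq z).hasFDerivAt
  have h2 := ((h1.const_mul (-(1 / (4 * t)))).exp).const_mul (1 / (4 * Real.pi * t) ^ ((n : ℝ) / 2))
  have h3 : heatKernel n t = fun z => 1 / (4 * Real.pi * t) ^ ((n : ℝ) / 2) *
      Real.exp (-(1 / (4 * t)) * ‖z‖ ^ 2) := by
    funext z
    exact heatKernel_eq t z
  rw [h3]
  convert! h2 using 1
  ext e
  simp [heatKernelFDeriv, heatKernel_eq]
  field_simp
  ring

/-- The gradient of the heat semigroup. -/
def heatGrad (t : ℝ) (u : E n → ℝ) (x : E n) : E n →L[ℝ] ℝ :=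
  ∫ z, u z • heatKernelFDeriv n t (x - z)

lemma integrable_heatGrad {u : E n → ℝ} {M t : ℝ} (hu : BM u M) (ht : 0 < t) (x : E n) :
    Integrable (fun z => u z • heatKernelFDeriv n t (x - z)) := by
  have h1 : Integrable (fun z : E n => M * (gradC n / Real.sqrt t * heatKernel n (2 * t) (x - z))) :=
    (((integrable_heatKernel (by positivity)).comp_sub_left x).const_mul _).const_mul _
  refine h1.mono' (hu.aesm.smul ((continuous_heatKernelFDeriv t).comp
    (continuous_const.sub continuous_id)).aestronglyMeasurable) ?_
  filter_upwards [hu.bd] with z hz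
  rw [norm_smul]
  exact mul_le_mul hz (norm_heatKernelFDeriv_le ht _) (norm_nonneg _) hu.nonneg

lemma BM.heatGrad_apply {u : E n → ℝ} {M t : ℝ} (hu : BM u M) (ht : 0 < t) (x e : E n) :
    heatGrad t u x e = HeatHolder.conv (gradKernel n t e) u x := by
  rw [heatGrad, ContinuousLinearMap.integral_apply (integrable_heatGrad hu ht x),
    conv_eq_integral_sub]
  refine integral_congr_ae (ae_of_all _ fun z => ?_)
  simp [heatKernelFDeriv_apply, mul_comm]

lemma BM.hasFDerivAt_heatSemigroup {u : E n → ℝ} {M t : ℝ} (hu : BM u M) (ht : 0 < t) (x : E n) :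
    HasFDerivAt (HeatHolder.heatSemigroup t u) (heatGrad t u x) x := by
  have h0 : Integrable (fun z : E n => M * (gradC n / Real.sqrt t *
      (kc n * Real.exp (1 / (4 * (2 * t))) * heatKernel n (2 * (2 * t)) (x - z)))) :=
    ((((integrable_heatKernel (by positivity)).comp_sub_left x).const_mul _).const_mul _).const_mul _
  refine hasFDerivAt_integral_of_dominated_of_fderiv_le (Metric.ball_mem_nhds x one_pos) ?_ ?_
    (F' := fun y z => u z • heatKernelFDeriv n t (y - z)) (integrable_heatGrad hu ht x).1 ?_ h0 ?_
  · exact Eventually.of_forall fun y => ((continuous_heatKernel t).comp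
      (continuous_const.sub continuous_id)).aestronglyMeasurable.mul hu.aesm
  · exact BM.integrable_mul ((integrable_heatKernel ht).comp_sub_left x) hu
  · filter_upwards [hu.bd] with z hz y hy
    rw [norm_smul]
    refine mul_le_mul hz ((norm_heatKernelFDeriv_le ht _).trans ?_) (norm_nonneg _) hu.nonneg
    have := gradC_nonneg n
    refine mul_le_mul_of_nonneg_left ?_ (by positivity)
    have := heatKernel_add_le (t := 2 * t) (by positivity) (x - z) (h := y - x)
      (by simpa [dist_eq_norm] using (Metric.mem_ball.1 hy).le)
    simpa using this
  · refine ae_of_all _ fun z y _ => ?_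
    have h1 : HasFDerivAt (fun y => heatKernel n t (y - z)) (heatKernelFDeriv n t (y - z)) y := by
      simpa only [ContinuousLinearMap.comp_id] using!
        (hasFDerivAt_heatKernel ht (y - z)).comp y ((hasFDerivAt_id y).sub_const z)
    exact h1.mul_const (u z)

lemma BM.continuous_heatSemigroup {u : E n → ℝ} {M t : ℝ} (hu : BM u M) (ht : 0 < t) :
    Continuous (HeatHolder.heatSemigroup t u) :=
  continuous_iff_continuousAt.2 fun x => (hu.hasFDerivAt_heatSemigroup ht x).continuousAt

lemma BM.norm_heatGrad_le {u : E n → ℝ} {M t : ℝ} (hu : BM u M) (ht : 0 < t) (x : E n) :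
    ‖heatGrad t u x‖ ≤ gradC n / Real.sqrt t * M := by
  have := gradC_nonneg n
  have := hu.nonneg
  refine ContinuousLinearMap.opNorm_le_bound _ (by positivity) fun e => ?_
  rw [hu.heatGrad_apply ht]
  refine (hu.abs_gradConv_le ht e x).trans_eq ?_
  ring

/-! ### Time derivatives of the heat semigroup -/

/-- The time derivative `∂_t^k e^{tΔ}u(x)`. -/
def heatDeriv (k : ℕ) (u : E n → ℝ) (t : ℝ) (x : E n) : ℝ :=
  iteratedDeriv k (fun s : ℝ => heatSemigroup s u x) t

lemma heatDeriv_zero (u : E n → ℝ) (t : ℝ) : heatDeriv 0 u t = heatSemigroup t u := by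
  funext x
  simp [heatDeriv]

lemma heatSemigroup_congr_ae {u v : E n → ℝ} (h : u =ᵐ[volume] v) (t : ℝ) :
    heatSemigroup t u = heatSemigroup t v := by
  rw [heatSemigroup_eq_conv, heatSemigroup_eq_conv, conv_congr_ae h]

lemma heatDeriv_congr_ae {u v : E n → ℝ} (h : u =ᵐ[volume] v) (k : ℕ) (t : ℝ) :
    heatDeriv k u t = heatDeriv k v t := by
  funext x
  simp only [heatDeriv, heatSemigroup_congr_ae h]

/-- One step of differentiation in time, given the semigroup property of `heatDeriv k`. -/
lemma hasDerivAt_heatDeriv_aux {u : E n → ℝ} {k : ℕ} {s t M : ℝ} (hs : 0 < s)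
    (hb : BM (heatDeriv k u t) M)
    (hsg : ∀ s x, 0 < s → heatDeriv k u (s + t) x = heatSemigroup s (heatDeriv k u t) x) (x : E n) :
    HasDerivAt (fun r => heatDeriv k u r x) (conv (timeKernel n s) (heatDeriv k u t) x) (s + t) := by
  have h1 : HasDerivAt (fun r => heatSemigroup r (heatDeriv k u t) x)
      (conv (timeKernel n s) (heatDeriv k u t) x) (s + t - t) := by
    rw [add_sub_cancel_right]
    exact hb.hasDerivAt_heatSemigroup hs x
  have h2 := h1.comp_sub_const (s + t) t
  refine h2.congr_of_eventuallyEq ?_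
  filter_upwards [lt_mem_nhds (show t < s + t by linarith)] with r hr
  rw [← hsg (r - t) x (by linarith), sub_add_cancel]

/-- The bound and the semigroup property go through one induction, since each new derivative needs
both: the semigroup property moves it onto the kernel, and the bound makes the resulting convolution
meaningful. -/
lemma heatDeriv_spec (n k : ℕ) : ∃ C : ℝ, 0 ≤ C ∧ ∀ (u : E n → ℝ) (M : ℝ), BM u M →
    (∀ t, 0 < t → AEStronglyMeasurable (heatDeriv k u t) volume ∧
      ∀ x, |heatDeriv k u t x| ≤ C / t ^ k * M) ∧
    ∀ s t x, 0 < s → 0 < t → heatDeriv k u (s + t) x = heatSemigroup s (heatDeriv k u t) x := by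
  induction k with
  | zero =>
    refine ⟨1, zero_le_one, fun u M hu => ⟨fun t ht => ?_, fun s t x hs ht => ?_⟩⟩
    · rw [heatDeriv_zero]
      simpa using ⟨(hu.heatSemigroup ht).aesm, hu.abs_heatSemigroup_le ht⟩
    · rw [heatDeriv_zero, heatDeriv_zero, hu.heatSemigroup_add hs ht]
  | succ k ih =>
    obtain ⟨C, hC, ih⟩ := ih
    have hT := timeC_nonneg n
    refine ⟨timeC n * 2 * 2 ^ k * C, by positivity, fun u M hu => ?_⟩
    obtain ⟨h1, h2⟩ := ih u M hu
    have hb : ∀ t, 0 < t → BM (heatDeriv k u t) (C / t ^ k * M) := fun t ht =>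
      .of_le (h1 t ht).1 (h1 t ht).2
    have key : ∀ s t, 0 < s → 0 < t →
        heatDeriv (k + 1) u (s + t) = conv (timeKernel n s) (heatDeriv k u t) := by
      intro s t hs ht
      funext x
      have := (hasDerivAt_heatDeriv_aux hs (hb t ht) (fun s x hs => h2 s t x hs ht) x).deriv
      rw [← this, heatDeriv, iteratedDeriv_succ]
      rfl
    refine ⟨fun t ht => ?_, fun s t x hs ht => ?_⟩
    · have h3 := key (t / 2) (t / 2) (by positivity) (by positivity)
      rw [add_halves] at h3
      have h4 := hb (t / 2) (by positivity)
      rw [h3]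
      refine ⟨(h4.timeConv (by positivity)).aesm, fun x =>
        (h4.abs_timeConv_le (by positivity) x).trans_eq ?_⟩
      rw [div_pow, pow_succ]
      field_simp
    · have h3 := key (t / 2) (t / 2) (by positivity) (by positivity)
      have h4 := key (s + t / 2) (t / 2) (by positivity) (by positivity)
      rw [add_halves] at h3
      rw [add_assoc, add_halves] at h4
      rw [h4, h3, (hb (t / 2) (by positivity)).timeConv_add hs (by positivity)]

/-- A constant in `|∂_t^k e^{tΔ}u| ≤ C t^{-k} ‖u‖_∞`. -/
def derivC (n k : ℕ) : ℝ := (heatDeriv_spec n k).choose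

lemma derivC_nonneg (n k : ℕ) : 0 ≤ derivC n k := (heatDeriv_spec n k).choose_spec.1

lemma BM.abs_heatDeriv_le {u : E n → ℝ} {M t : ℝ} (hu : BM u M) (k : ℕ) (ht : 0 < t) (x : E n) :
    |heatDeriv k u t x| ≤ derivC n k / t ^ k * M :=
  (((heatDeriv_spec n k).choose_spec.2 u M hu).1 t ht).2 x

lemma BM.heatDeriv {u : E n → ℝ} {M t : ℝ} (hu : BM u M) (k : ℕ) (ht : 0 < t) :
    BM (heatDeriv k u t) (derivC n k / t ^ k * M) :=
  .of_le (((heatDeriv_spec n k).choose_spec.2 u M hu).1 t ht).1 (hu.abs_heatDeriv_le k ht)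

lemma BM.heatDeriv_add {u : E n → ℝ} {M s t : ℝ} (hu : BM u M) (k : ℕ) (hs : 0 < s) (ht : 0 < t) :
    HeatHolder.heatDeriv k u (s + t) = HeatHolder.heatSemigroup s (HeatHolder.heatDeriv k u t) :=
  funext fun x => ((heatDeriv_spec n k).choose_spec.2 u M hu).2 s t x hs ht

lemma BM.hasDerivAt_heatDeriv {u : E n → ℝ} {M t : ℝ} (hu : BM u M) (k : ℕ) (ht : 0 < t)
    (x : E n) : HasDerivAt (fun r => HeatHolder.heatDeriv k u r x)
      (HeatHolder.heatDeriv (k + 1) u t x) t := by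
  have h := hasDerivAt_heatDeriv_aux (s := t / 2) (by positivity) (hu.heatDeriv k (half_pos ht))
    (fun s x hs => congrFun (hu.heatDeriv_add k hs (half_pos ht)) x) x
  rw [add_halves] at h
  have h2 : HeatHolder.heatDeriv (k + 1) u t x = deriv (fun r => HeatHolder.heatDeriv k u r x) t := by
    rw [HeatHolder.heatDeriv, iteratedDeriv_succ]
    rfl
  rw [h2]
  exact h.differentiableAt.hasDerivAt

lemma BM.heatDeriv_comp {u : E n → ℝ} {M s t : ℝ} (hu : BM u M) (j k : ℕ) (hs : 0 < s)
    (ht : 0 < t) : HeatHolder.heatDeriv j (HeatHolder.heatDeriv k u t) s =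
      HeatHolder.heatDeriv (j + k) u (s + t) := by
  funext x
  have h1 : (fun r => HeatHolder.heatSemigroup r (HeatHolder.heatDeriv k u t) x) =ᶠ[𝓝 s]
      fun r => HeatHolder.heatDeriv k u (r + t) x := by
    filter_upwards [lt_mem_nhds hs] with r hr
    rw [hu.heatDeriv_add k hr ht]
  rw [HeatHolder.heatDeriv, h1.iteratedDeriv_eq,
    iteratedDeriv_comp_add_const j (fun r => HeatHolder.heatDeriv k u r x) t]
  simp only [HeatHolder.heatDeriv, iteratedDeriv_eq_iterate, Function.iterate_add_apply]

lemma BM.heatDeriv_one {u : E n → ℝ} {M t : ℝ} (hu : BM u M) (ht : 0 < t) :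
    HeatHolder.heatDeriv 1 u t = HeatHolder.conv (timeKernel n t) u := by
  funext x
  rw [HeatHolder.heatDeriv, iteratedDeriv_one]
  exact (hu.hasDerivAt_heatSemigroup ht x).deriv

/-- Used with both times equal to half the total time: one derivative on the kernel, the rest on a
function already controlled. -/
lemma BM.heatDeriv_succ {u : E n → ℝ} {M s t : ℝ} (hu : BM u M) (k : ℕ) (hs : 0 < s) (ht : 0 < t) :
    HeatHolder.heatDeriv (k + 1) u (s + t) =
      HeatHolder.conv (timeKernel n s) (HeatHolder.heatDeriv k u t) := by
  rw [← (hu.heatDeriv k ht).heatDeriv_one hs, hu.heatDeriv_comp 1 k hs ht, add_comm]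

/-! ### Comparison of functions on the half-line -/

/-- `g - c f` is monotone for `c = ±1`, so derivative bounds integrate without any integrability of
`f'`. -/
lemma abs_sub_le_of_abs_deriv_le {f f' g g' : ℝ → ℝ} {s t : ℝ} (hst : s ≤ t)
    (hf : ∀ r ∈ Set.Icc s t, HasDerivAt f (f' r) r) (hg : ∀ r ∈ Set.Icc s t, HasDerivAt g (g' r) r)
    (h : ∀ r ∈ Set.Icc s t, |f' r| ≤ g' r) : |f t - f s| ≤ g t - g s := by
  have aux : ∀ c : ℝ, |c| = 1 → c * (f t - f s) ≤ g t - g s := by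
    intro c hc
    have hm : MonotoneOn (fun r => g r - c * f r) (Set.Icc s t) := by
      have hd : ∀ r ∈ Set.Icc s t, HasDerivAt (fun r => g r - c * f r) (g' r - c * f' r) r :=
        fun r hr => (hg r hr).sub ((hf r hr).const_mul c)
      refine monotoneOn_of_deriv_nonneg (convex_Icc s t)
        (fun r hr => (hd r hr).continuousAt.continuousWithinAt)
        (fun r hr => (hd r (interior_subset hr)).differentiableAt.differentiableWithinAt)
        fun r hr => ?_
      rw [(hd r (interior_subset hr)).deriv]
      have h1 := h r (interior_subset hr)
      have h2 := le_abs_self (c * f' r)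
      rw [abs_mul, hc, one_mul] at h2
      linarith
    have := hm (Set.left_mem_Icc.2 hst) (Set.right_mem_Icc.2 hst) hst
    simp only at this
    linarith
  rw [abs_le]
  have h1 := aux 1 (by simp)
  have h2 := aux (-1) (by simp)
  constructor <;> linarith

lemma hasDerivAt_rpow_const_mul {a A r : ℝ} (ha : a ≠ 0) (hr : 0 < r) :
    HasDerivAt (fun r : ℝ => A / a * r ^ a) (A * r ^ (a - 1)) r := by
  have := (Real.hasDerivAt_rpow_const (x := r) (p := a) (Or.inl hr.ne')).const_mul (A / a)
  convert! this using 1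
  field_simp

/-- Integration from `t` to `∞`. -/
lemma abs_le_of_abs_deriv_le_rpow {f f' : ℝ → ℝ} {a A : ℝ} (ha : a < 0)
    (hf : ∀ r, 0 < r → HasDerivAt f (f' r) r) (h : ∀ r, 0 < r → |f' r| ≤ A * r ^ (a - 1))
    (hlim : Tendsto f atTop (𝓝 0)) {t : ℝ} (ht : 0 < t) : |f t| ≤ A / (-a) * t ^ a := by
  have h1 : ∀ T, t ≤ T → |f T - f t| ≤ A / a * T ^ a - A / a * t ^ a := fun T hT =>
    abs_sub_le_of_abs_deriv_le hT (fun r hr => hf r (ht.trans_le hr.1))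
      (fun r hr => hasDerivAt_rpow_const_mul ha.ne (ht.trans_le hr.1))
      (fun r hr => h r (ht.trans_le hr.1))
  have h2 : Tendsto (fun T => |f T - f t|) atTop (𝓝 |0 - f t|) := (hlim.sub_const _).abs
  have h3 : Tendsto (fun T : ℝ => A / a * T ^ a - A / a * t ^ a) atTop
      (𝓝 (A / a * 0 - A / a * t ^ a)) := by
    refine Tendsto.sub_const (Tendsto.const_mul _ ?_) _
    simpa using tendsto_rpow_neg_atTop (y := -a) (by linarith)
  have h4 := le_of_tendsto_of_tendsto h2 h3 ((eventually_ge_atTop t).mono h1)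
  rw [zero_sub, abs_neg] at h4
  rw [div_neg]
  linarith

/-! ### The decay condition defining `Λ^α` -/

/-- The decay `|∂_t^k e^{tΔ}u| ≤ A t^{α/2 - k}`. -/
def HeatBound (α : ℝ) (k : ℕ) (u : E n → ℝ) (A : ℝ) : Prop :=
  ∀ x t, 0 < t → |heatDeriv k u t x| ≤ A * t ^ (α / 2 - k)

lemma HeatBound.nonneg {α A : ℝ} {k : ℕ} {u : E n → ℝ} (h : HeatBound α k u A) : 0 ≤ A := by
  have := h 0 1 one_pos
  rw [Real.one_rpow, mul_one] at this
  exact (abs_nonneg _).trans this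

lemma HeatBound.mono {α A B : ℝ} {k : ℕ} {u : E n → ℝ} (h : HeatBound α k u A) (hAB : A ≤ B) :
    HeatBound α k u B := fun x t ht =>
  (h x t ht).trans (mul_le_mul_of_nonneg_right hAB (by positivity))

lemma HeatBound.congr_ae {α A : ℝ} {k : ℕ} {u v : E n → ℝ} (h : HeatBound α k u A)
    (huv : u =ᵐ[volume] v) : HeatBound α k v A := fun x t ht => by
  rw [← heatDeriv_congr_ae huv]
  exact h x t ht

lemma HeatBound.bm {α A M t : ℝ} {k : ℕ} {u : E n → ℝ} (h : HeatBound α k u A) (hu : BM u M)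
    (ht : 0 < t) : BM (heatDeriv k u t) (A * t ^ (α / 2 - k)) :=
  .of_le (hu.heatDeriv k ht).aesm fun x => h x t ht

/-- The extra derivative is put on the kernel at time `t/2`, where it costs a multiple of `t⁻¹`. -/
lemma HeatBound.raise {α A M : ℝ} {k : ℕ} {u : E n → ℝ} (h : HeatBound α k u A) (hu : BM u M) :
    HeatBound α (k + 1) u (timeC n * (1 / 2) ^ (α / 2 - k - 1) * A) := by
  intro x t ht
  have ht2 := half_pos ht
  have h1 := hu.heatDeriv_succ k ht2 ht2
  rw [add_halves] at h1
  rw [h1]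
  refine ((h.bm hu ht2).abs_timeConv_le ht2 x).trans_eq ?_
  have h2 : α / 2 - ((k + 1 : ℕ) : ℝ) = α / 2 - k - 1 := by push_cast; ring
  have h3 : (t / 2) ^ (α / 2 - k) = (t / 2) ^ (α / 2 - k - 1) * (t / 2) := by
    rw [← Real.rpow_add_one ht2.ne']
    congr 1
    ring
  have h4 : (t / 2) ^ (α / 2 - k - 1) = (1 / 2) ^ (α / 2 - k - 1) * t ^ (α / 2 - k - 1) := by
    rw [← Real.mul_rpow (by norm_num) ht.le]
    congr 1
    ring
  rw [h2, h3, h4]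
  field_simp

lemma BM.tendsto_heatDeriv {u : E n → ℝ} {M : ℝ} (hu : BM u M) {k : ℕ} (hk : k ≠ 0) (x : E n) :
    Tendsto (fun t => HeatHolder.heatDeriv k u t x) atTop (𝓝 0) := by
  have h1 : Tendsto (fun t : ℝ => derivC n k / t ^ k * M) atTop (𝓝 (0 * M)) :=
    (Tendsto.const_div_atTop (tendsto_pow_atTop hk) _).mul_const M
  rw [zero_mul] at h1
  refine squeeze_zero_norm' ?_ h1
  filter_upwards [eventually_gt_atTop 0] with t ht
  exact hu.abs_heatDeriv_le k ht x

/-- Integration from `t` to `∞`. The condition `α/2 < k` makes `r^{α/2-k-1}` integrable at infinity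
and, as `α > 0`, forces `k ≥ 1`, so that `∂_t^k e^{tΔ}u` tends to `0` for bounded `u`. -/
lemma HeatBound.lower {α A M : ℝ} {k : ℕ} {u : E n → ℝ} (hα : 0 < α) (hk : α / 2 < k)
    (h : HeatBound α (k + 1) u A) (hu : BM u M) : HeatBound α k u (1 / (k - α / 2) * A) := by
  intro x t ht
  have hk0 : k ≠ 0 := by
    rintro rfl
    simp at hk
    linarith
  have := abs_le_of_abs_deriv_le_rpow (a := α / 2 - k) (A := A) (by linarith)
    (fun r hr => hu.hasDerivAt_heatDeriv k hr x) (fun r hr => by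
      convert h x r hr using 3
      push_cast
      ring) (hu.tendsto_heatDeriv hk0 x) ht
  refine this.trans_eq ?_
  rw [neg_sub]
  ring

/-- The order of differentiation is immaterial. Only the target order has to exceed `α/2`. -/
lemma HeatBound.change (n : ℕ) {α : ℝ} (hα : 0 < α) {k l : ℕ} (hl : α / 2 < l) :
    ∃ C : ℝ, 0 ≤ C ∧ ∀ (u : E n → ℝ) (M A : ℝ), BM u M → HeatBound α k u A →
      HeatBound α l u (C * A) := by
  rcases le_total k l with hkl | hkl
  -- Raising the order needs no lower bound on it; keeping `hl` would only weaken the induction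
  -- hypothesis.
  · clear hl
    induction l, hkl using Nat.le_induction with
    | base => exact ⟨1, zero_le_one, fun u M A _ h => by rwa [one_mul]⟩
    | succ l hl ih =>
      obtain ⟨C, hC, ih⟩ := ih
      have := timeC_nonneg n
      refine ⟨timeC n * (1 / 2) ^ (α / 2 - l - 1) * C, by positivity, fun u M A hu h => ?_⟩
      rw [mul_assoc]
      exact (ih u M A hu h).raise hu
  · induction k, hkl using Nat.le_induction with
    | base => exact ⟨1, zero_le_one, fun u M A _ h => by rwa [one_mul]⟩
    | succ k hk ih =>
      obtain ⟨C, hC, ih⟩ := ih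
      have hk' : α / 2 < k := hl.trans_le (by exact_mod_cast hk)
      have : 0 < k - α / 2 := by linarith
      refine ⟨C * (1 / (k - α / 2)), by positivity, fun u M A hu h => ?_⟩
      rw [mul_assoc]
      exact ih u M _ hu (h.lower hα hk' hu)

/-- For `t ≤ 1` a smaller exponent is a weaker demand; for `t ≥ 1` boundedness of `u` alone gives
`t^{-k}`, which suffices since `α' ≥ 0`. -/
lemma HeatBound.smaller {α α' A M : ℝ} {k : ℕ} {u : E n → ℝ} (h : HeatBound α k u A) (hu : BM u M)
    (hα : 0 ≤ α') (hαα : α' ≤ α) : HeatBound α' k u (A + derivC n k * M) := by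
  intro x t ht
  have hA := h.nonneg
  have hM := hu.nonneg
  have hC := derivC_nonneg n k
  rcases le_total t 1 with ht1 | ht1
  · calc _ ≤ A * t ^ (α / 2 - k) := h x t ht
      _ ≤ A * t ^ (α' / 2 - k) := by
        gcongr 1
        exact Real.rpow_le_rpow_of_exponent_ge ht ht1 (by linarith)
      _ ≤ _ := by
        gcongr
        nlinarith [mul_nonneg hC hM]
  · calc _ ≤ derivC n k / t ^ k * M := hu.abs_heatDeriv_le k ht x
      _ = derivC n k * M * t ^ (-(k : ℝ)) := by
        rw [Real.rpow_neg ht.le, Real.rpow_natCast]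
        ring
      _ ≤ derivC n k * M * t ^ (α' / 2 - k) := by
        gcongr
        linarith
      _ ≤ _ := by
        gcongr
        linarith

/-- Lowering both the exponent and the order of differentiation. -/
lemma HeatBound.reduce (n : ℕ) {α α' : ℝ} (hα : 0 < α') (hαα : α' ≤ α) {k l : ℕ}
    (hl : α' / 2 < l) : ∃ C : ℝ, 0 ≤ C ∧ ∀ (u : E n → ℝ) (M A : ℝ), BM u M → HeatBound α k u A →
      HeatBound α' l u (C * (M + A)) := by
  obtain ⟨C, hC, h⟩ := HeatBound.change n hα (k := k) hl
  have hD := derivC_nonneg n k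
  refine ⟨C * (1 + derivC n k), by positivity, fun u M A hu hA => ?_⟩
  refine (h u M _ hu (hA.smaller hu hα.le hαα)).mono ?_
  rw [mul_assoc]
  gcongr
  nlinarith [hu.nonneg, hA.nonneg, mul_nonneg hD hA.nonneg]

/-! ### From decay to regularity: limits at time zero -/

lemma tendsto_const_mul_rpow_zero (A : ℝ) {a : ℝ} (ha : 0 < a) :
    Tendsto (fun t : ℝ => A * t ^ a) (𝓝 0) (𝓝 0) := by
  have : Tendsto (fun t : ℝ => A * t ^ a) (𝓝 0) (𝓝 (A * 0 ^ a)) :=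
    ((Real.continuousAt_rpow_const 0 a (Or.inr ha.le)).tendsto).const_mul A
  rwa [Real.zero_rpow ha.ne', mul_zero] at this

/-- A family with an integrable time derivative converges uniformly as `t → 0`. -/
lemma exists_limit_of_holder_in_time {X F : Type*} [NormedAddCommGroup F] [CompleteSpace F]
    {f : ℝ → X → F} {a A : ℝ} (ha : 0 < a)
    (h : ∀ s t x, 0 < s → s ≤ t → ‖f t x - f s x‖ ≤ A * t ^ a - A * s ^ a) :
    ∃ g : X → F, ∀ t x, 0 < t → ‖f t x - g x‖ ≤ A * t ^ a := by
  have hr : Tendsto (fun t : ℝ => A * t ^ a) (𝓝[>] 0) (𝓝 0) :=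
    (tendsto_const_mul_rpow_zero A ha).mono_left nhdsWithin_le_nhds
  have hlim : ∀ x, ∃ y, Tendsto (fun t => f t x) (𝓝[>] 0) (𝓝 y) := by
    intro x
    refine CompleteSpace.complete (Metric.cauchy_iff.2 ⟨inferInstance, fun ε hε => ?_⟩)
    obtain ⟨δ, hδ, hδε⟩ := Metric.tendsto_nhdsWithin_nhds.1 hr (ε / 4) (by positivity)
    refine ⟨(fun t => f t x) '' Set.Ioo 0 δ, image_mem_map (Ioo_mem_nhdsGT hδ), ?_⟩
    have hb : ∀ t ∈ Set.Ioo 0 δ, |A * t ^ a| < ε / 4 := fun t ht => by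
      have := hδε ht.1 (by rw [dist_zero_right, Real.norm_of_nonneg ht.1.le]; exact ht.2)
      rwa [dist_zero_right] at this
    rintro _ ⟨s, hs, rfl⟩ _ ⟨t, ht, rfl⟩
    wlog hst : s ≤ t generalizing s t
    · rw [dist_comm]
      exact this t ht s hs (le_of_not_ge hst)
    rw [dist_comm, dist_eq_norm]
    have h1 := h s t x hs.1 hst
    have h2 := abs_lt.1 (hb s hs)
    have h3 := abs_lt.1 (hb t ht)
    linarith
  choose g hg using hlim
  refine ⟨g, fun t x ht => ?_⟩
  have h1 : Tendsto (fun s => ‖f t x - f s x‖) (𝓝[>] 0) (𝓝 ‖f t x - g x‖) :=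
    ((hg x).const_sub _).norm
  have h2 : Tendsto (fun s => A * t ^ a - A * s ^ a) (𝓝[>] 0) (𝓝 (A * t ^ a - 0)) := hr.const_sub _
  rw [sub_zero] at h2
  refine le_of_tendsto_of_tendsto h1 h2 ?_
  filter_upwards [Ioo_mem_nhdsGT ht] with s hs
  exact h s t x hs.1 hs.2.le

lemma BM.locallyIntegrable {u : E n → ℝ} {M : ℝ} (hu : BM u M) : LocallyIntegrable u volume :=
  (memLp_top_of_bound hu.aesm M hu.bd).locallyIntegrable le_top

lemma heatKernel_sqrt_smul {t : ℝ} (ht : 0 < t) (y : E n) :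
    heatKernel n t (Real.sqrt t • y) = (Real.sqrt t ^ n)⁻¹ * heatKernel n 1 y := by
  have h1 : Real.sqrt t ^ n = t ^ ((n : ℝ) / 2) := by
    rw [Real.sqrt_eq_rpow, ← Real.rpow_natCast, ← Real.rpow_mul ht.le]
    congr 1
    ring
  have h2 : -(‖Real.sqrt t • y‖ ^ 2) / (4 * t) = -(‖y‖ ^ 2) / (4 * 1) := by
    rw [norm_smul, mul_pow, Real.norm_eq_abs, sq_abs, Real.sq_sqrt ht.le]
    field_simp
  rw [h1, heatKernel, heatKernel, h2, Real.mul_rpow (by positivity) ht.le, mul_one]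
  field_simp

/-- The change of variables `z = √t y`. -/
lemma integral_heatKernel_mul_scale {t : ℝ} (ht : 0 < t) (f : E n → ℝ) :
    ∫ z, heatKernel n t z * f z = ∫ y, heatKernel n 1 y * f (Real.sqrt t • y) := by
  have hs : 0 < Real.sqrt t ^ n := pow_pos (Real.sqrt_pos.2 ht) n
  have h := Measure.integral_comp_smul volume (fun z => heatKernel n t z * f z) (Real.sqrt t)
  rw [finrank_euclideanSpace_fin, abs_of_pos (inv_pos.2 hs), smul_eq_mul] at h
  simp_rw [heatKernel_sqrt_smul ht, mul_assoc] at h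
  rw [integral_const_mul] at h
  exact (mul_left_cancel₀ (inv_pos.2 hs).ne' h).symm

/-- `e^{tΔ}u → u` in the sense of distributions. -/
lemma BM.tendsto_integral_mul_heatSemigroup {u : E n → ℝ} {M : ℝ} (hu : BM u M) {φ : E n → ℝ}
    (hφ : Continuous φ) (hc : HasCompactSupport φ) :
    Tendsto (fun t => ∫ x, φ x * HeatHolder.heatSemigroup t u x) (𝓝[>] 0) (𝓝 (∫ x, φ x * u x)) := by
  have hφi : Integrable φ := hφ.integrable_of_hasCompactSupport hc
  -- The pairing of `φ` with `e^{tΔ}u` is a Gaussian average of `H` at scale `√t`. Smoothing by `φ`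
  -- makes `H` continuous although `u` is only measurable, so the average tends to `H 0`.
  set H : E n → ℝ := fun h => ∫ x, φ x * u (x - h) with hH
  have hHb : ∀ h, |H h| ≤ (∫ x, |φ x|) * M := by
    intro h
    rw [← integral_mul_const]
    refine norm_integral_le_of_norm_le (f := fun x => φ x * u (x - h)) (hφi.norm.mul_const M) ?_
    filter_upwards [(measurePreserving_sub_right volume h).quasiMeasurePreserving.ae hu.bd] with z hz
    rw [norm_mul]
    exact mul_le_mul_of_nonneg_left hz (abs_nonneg _)
  have hHc : Continuous H := by
    have h1 : Continuous (convolution φ (fun z => u (0 - z)) (ContinuousLinearMap.mul ℝ ℝ) volume) :=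
      hc.continuous_convolution_left _ hφ (hu.comp_sub_left 0).locallyIntegrable
    convert! h1 using 1
    funext h
    simp [hH, convolution]
  have hH0 : H 0 = ∫ x, φ x * u x := by simp [hH]
  have key : ∀ t, 0 < t → ∫ x, φ x * HeatHolder.heatSemigroup t u x =
      ∫ y, heatKernel n 1 y * H (Real.sqrt t • y) := by
    intro t ht
    rw [← integral_heatKernel_mul_scale ht]
    simp_rw [heatSemigroup_eq_conv, HeatHolder.conv, hH, ← integral_const_mul]
    rw [integral_integral_swap]
    · refine integral_congr_ae (ae_of_all _ fun z => ?_)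
      refine integral_congr_ae (ae_of_all _ fun x => ?_)
      simp only
      ring
    have h1 : Integrable (fun p : E n × E n => φ p.1 * heatKernel n t p.2) (volume.prod volume) :=
      hφi.mul_prod (integrable_heatKernel ht)
    have hq := quasiMeasurePreserving_sub_of_right_invariant (volume : Measure (E n))
      (volume : Measure (E n))
    have h2 : Integrable (fun p : E n × E n => φ p.1 * heatKernel n t p.2 * u (p.1 - p.2))
        (volume.prod volume) := by
      refine (h1.norm.mul_const M).mono'
        (h1.aestronglyMeasurable.mul (hu.aesm.comp_quasiMeasurePreserving hq)) ?_
      filter_upwards [hq.ae hu.bd] with p hp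
      rw [norm_mul]
      exact mul_le_mul_of_nonneg_left hp (norm_nonneg _)
    exact h2.congr (ae_of_all _ fun p => mul_assoc _ _ _)
  have hlim : Tendsto (fun t : ℝ => ∫ y, heatKernel n 1 y * H (Real.sqrt t • y)) (𝓝[>] 0)
      (𝓝 (∫ y, heatKernel n 1 y * H 0)) := by
    refine tendsto_integral_filter_of_dominated_convergence
      (fun y => heatKernel n 1 y * ((∫ x, |φ x|) * M)) ?_ ?_
      ((integrable_heatKernel one_pos).mul_const _) ?_
    · exact Eventually.of_forall fun t => ((continuous_heatKernel 1).mul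
        (hHc.comp (continuous_const_smul _))).aestronglyMeasurable
    · refine Eventually.of_forall fun t => ae_of_all _ fun y => ?_
      rw [norm_mul, Real.norm_of_nonneg (heatKernel_pos one_pos y).le]
      exact mul_le_mul_of_nonneg_left (hHb _) (heatKernel_pos one_pos y).le
    · refine ae_of_all _ fun y => (Tendsto.const_mul _ ?_)
      have : Continuous fun t : ℝ => H (Real.sqrt t • y) := by fun_prop
      simpa using (this.tendsto 0).mono_left nhdsWithin_le_nhds
  rw [integral_mul_const, integral_heatKernel one_pos, one_mul, hH0] at hlim
  refine hlim.congr' ?_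
  filter_upwards [self_mem_nhdsWithin] with t ht
  exact (key t ht).symm

/-- A uniform limit of `e^{tΔ}u` at time zero agrees with `u` almost everywhere. -/
lemma BM.ae_eq_of_limit {u v : E n → ℝ} {M a A : ℝ} (hu : BM u M) (ha : 0 < a)
    (h : ∀ t x, 0 < t → |HeatHolder.heatSemigroup t u x - v x| ≤ A * t ^ a) (hv : Continuous v) :
    u =ᵐ[volume] v := by
  refine ae_eq_of_integral_contDiff_smul_eq hu.locallyIntegrable hv.locallyIntegrable
    fun φ hφ hc => ?_
  have hφi : Integrable φ := hφ.continuous.integrable_of_hasCompactSupport hc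
  have h1 := hu.tendsto_integral_mul_heatSemigroup hφ.continuous hc
  have hr : Tendsto (fun t : ℝ => (∫ x, |φ x|) * (A * t ^ a)) (𝓝[>] 0) (𝓝 0) := by
    simpa using ((tendsto_const_mul_rpow_zero A ha).const_mul (∫ x, |φ x|)).mono_left
      nhdsWithin_le_nhds
  have h2 : Tendsto (fun t => ∫ x, φ x * HeatHolder.heatSemigroup t u x) (𝓝[>] 0)
      (𝓝 (∫ x, φ x * v x)) := by
    rw [tendsto_iff_norm_sub_tendsto_zero]
    refine squeeze_zero_norm' ?_ hr
    filter_upwards [self_mem_nhdsWithin] with t ht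
    have ht' : 0 < t := ht
    have i1 : Integrable (fun x => φ x * HeatHolder.heatSemigroup t u x) :=
      BM.integrable_mul hφi (hu.heatSemigroup ht')
    have i2 : Integrable (fun x => φ x * v x) :=
      (hφ.continuous.mul hv).integrable_of_hasCompactSupport hc.mul_right
    rw [norm_norm, ← integral_sub i1 i2, ← integral_mul_const]
    refine norm_integral_le_of_norm_le (hφi.norm.mul_const _) (ae_of_all _ fun x => ?_)
    rw [← mul_sub, norm_mul]
    exact mul_le_mul_of_nonneg_left (h t x ht) (norm_nonneg _)
  simpa using tendsto_nhds_unique h1 h2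

/-! ### First and second differences -/

lemma BM.abs_le_of_continuous {v : E n → ℝ} {M : ℝ} (hv : BM v M) (hc : Continuous v) (x : E n) :
    |v x| ≤ M := by
  have h1 : Dense {x | |v x| ≤ M} := Measure.dense_of_ae hv.bd
  have h2 : IsClosed {x | |v x| ≤ M} := isClosed_le hc.abs continuous_const
  have h3 : x ∈ closure {x | |v x| ≤ M} := h1 x
  rwa [h2.closure_eq] at h3

lemma BM.congr_ae {u v : E n → ℝ} {M : ℝ} (hu : BM u M) (h : u =ᵐ[volume] v) : BM v M := by
  refine ⟨hu.aesm.congr h, ?_⟩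
  filter_upwards [hu.bd, h] with x hx hxv
  rwa [← hxv]

lemma BM.abs_heatSemigroup_sub_le {u : E n → ℝ} {M t : ℝ} (hu : BM u M) (ht : 0 < t) (x h : E n) :
    |HeatHolder.heatSemigroup t u (x + h) - HeatHolder.heatSemigroup t u x| ≤
      gradC n / Real.sqrt t * ‖h‖ * M := by
  have := convex_univ.norm_image_sub_le_of_norm_hasFDerivWithin_le (s := Set.univ)
    (fun y _ => (hu.hasFDerivAt_heatSemigroup ht y).hasFDerivWithinAt)
    (fun y _ => hu.norm_heatGrad_le ht y) (Set.mem_univ x) (Set.mem_univ (x + h))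
  rw [add_sub_cancel_left] at this
  refine this.trans_eq ?_
  ring

lemma conv_sub_translate {K u : E n → ℝ} {M : ℝ} (hK : Integrable K) (hu : BM u M) (h x : E n) :
    conv K (fun y => u (y + h) - u y) x = conv K u (x + h) - conv K u x := by
  rw [conv, conv, conv, ← integral_sub]
  · refine integral_congr_ae (ae_of_all _ fun z => ?_)
    simp only
    rw [show x - z + h = x + h - z by abel]
    ring
  · exact BM.integrable_mul hK (hu.comp_sub_left _)
  · exact BM.integrable_mul hK (hu.comp_sub_left _)

/-- The symmetric second difference. -/
def secondDiff (v : E n → ℝ) (h x : E n) : ℝ := v (x + h) + v (x - h) - 2 * v x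

/-- A second difference is a first difference of first differences; each is estimated on one half of
the semigroup, at the price `|h| / √(t/2)`. -/
lemma BM.abs_secondDiff_heatSemigroup_le {u : E n → ℝ} {M t : ℝ} (hu : BM u M) (ht : 0 < t)
    (h x : E n) : |secondDiff (HeatHolder.heatSemigroup t u) h x| ≤
      2 * gradC n ^ 2 / t * ‖h‖ ^ 2 * M := by
  have ht2 := half_pos ht
  have hP := hu.heatSemigroup ht2
  set w : E n → ℝ := fun y => HeatHolder.heatSemigroup (t / 2) u (y + h) -
    HeatHolder.heatSemigroup (t / 2) u y with hw
  have hcont := hu.continuous_heatSemigroup ht2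
  have hwb : BM w (gradC n / Real.sqrt (t / 2) * ‖h‖ * M) :=
    .of_le (by fun_prop) fun y => hu.abs_heatSemigroup_sub_le ht2 y h
  have h1 : ∀ y, HeatHolder.heatSemigroup (t / 2) w y =
      HeatHolder.heatSemigroup t u (y + h) - HeatHolder.heatSemigroup t u y := by
    intro y
    have h2 : ∀ y, HeatHolder.heatSemigroup t u y =
        HeatHolder.conv (heatKernel n (t / 2)) (HeatHolder.heatSemigroup (t / 2) u) y := by
      intro y
      rw [← heatSemigroup_eq_conv, ← hu.heatSemigroup_add ht2 ht2, add_halves]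
    rw [h2, h2, ← conv_sub_translate (integrable_heatKernel ht2) hP, heatSemigroup_eq_conv]
  have h3 := hwb.abs_heatSemigroup_sub_le ht2 (x - h) h
  rw [h1, h1, sub_add_cancel] at h3
  have h4 : Real.sqrt (t / 2) * Real.sqrt (t / 2) = t / 2 := Real.mul_self_sqrt ht2.le
  have hs : 0 < Real.sqrt (t / 2) := Real.sqrt_pos.2 ht2
  refine (le_of_eq ?_).trans (h3.trans_eq ?_)
  · congr 1
    rw [secondDiff]
    ring
  · have h5 : t = 2 * (Real.sqrt (t / 2) * Real.sqrt (t / 2)) := by rw [h4]; ring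
    generalize Real.sqrt (t / 2) = r at *
    rw [h5]
    field_simp

lemma div_two_rpow {t a : ℝ} (ht : 0 < t) : (t / 2) ^ a = (1 / 2) ^ a * t ^ a := by
  rw [← Real.mul_rpow (by norm_num) ht.le]
  congr 1
  ring

lemma div_sqrt_eq {c t : ℝ} (ht : 0 < t) : c / Real.sqrt t = c * t ^ (-(1 / 2) : ℝ) := by
  rw [Real.rpow_neg ht.le, Real.sqrt_eq_rpow, div_eq_mul_inv]

lemma heatDeriv_half {u : E n → ℝ} {M t : ℝ} (hu : BM u M) (k : ℕ) (ht : 0 < t) :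
    heatDeriv k u t = heatSemigroup (t / 2) (heatDeriv k u (t / 2)) := by
  rw [← hu.heatDeriv_add k (half_pos ht) (half_pos ht), add_halves]

/-- The time derivative of the second difference is `O(|h|² r^{β/2-2})`. It is integrated from `t`
to `∞`, where the second difference vanishes since `u` is bounded; `β < 2` is the convergence
condition. -/
lemma HeatBound.abs_secondDiff_heatSemigroup_le {u : E n → ℝ} {M A β : ℝ} (hβ : β < 2)
    (hA : HeatBound β 1 u A) (hu : BM u M) (h x : E n) {t : ℝ} (ht : 0 < t) :
    |secondDiff (heatSemigroup t u) h x| ≤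
      4 * gradC n ^ 2 * (1 / 2) ^ (β / 2 - 1) / (1 - β / 2) * A * ‖h‖ ^ 2 * t ^ (β / 2 - 1) := by
  have h1 := abs_le_of_abs_deriv_le_rpow (a := β / 2 - 1)
    (A := 4 * gradC n ^ 2 * (1 / 2) ^ (β / 2 - 1) * A * ‖h‖ ^ 2)
    (f := fun t => secondDiff (heatSemigroup t u) h x)
    (f' := fun t => secondDiff (heatDeriv 1 u t) h x) (by linarith) ?_ ?_ ?_ ht
  · refine h1.trans_eq ?_
    rw [neg_sub]
    ring
  · intro r hr
    have hd : ∀ y, HasDerivAt (fun r => heatSemigroup r u y) (heatDeriv 1 u r y) r := fun y => by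
      have := hu.hasDerivAt_heatDeriv 0 hr y
      simpa only [heatDeriv_zero] using this
    exact ((hd (x + h)).add (hd (x - h))).sub ((hd x).const_mul 2)
  · intro r hr
    have hr2 := half_pos hr
    rw [heatDeriv_half hu 1 hr]
    refine ((hA.bm hu hr2).abs_secondDiff_heatSemigroup_le hr2 h x).trans_eq ?_
    rw [Nat.cast_one, div_two_rpow hr, Real.rpow_sub_one hr.ne' (β / 2 - 1)]
    field_simp
    ring
  · refine squeeze_zero_norm' (a := fun t => 2 * gradC n ^ 2 / t * ‖h‖ ^ 2 * M) ?_ ?_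
    · filter_upwards [eventually_gt_atTop 0] with r hr
      exact hu.abs_secondDiff_heatSemigroup_le hr h x
    · have : Tendsto (fun t : ℝ => 2 * gradC n ^ 2 / t * ‖h‖ ^ 2 * M) atTop
          (𝓝 (0 * ‖h‖ ^ 2 * M)) :=
        ((Tendsto.const_div_atTop tendsto_id _).mul_const _).mul_const _
      simpa using this

/-- Same argument with first differences. Convergence now requires `β < 1`, the point where the
Hölder and Zygmund cases part. -/
lemma HeatBound.abs_sub_heatSemigroup_le {u : E n → ℝ} {M A β : ℝ} (hβ : β < 1)
    (hA : HeatBound β 1 u A) (hu : BM u M) (h x : E n) {t : ℝ} (ht : 0 < t) :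
    |heatSemigroup t u (x + h) - heatSemigroup t u x| ≤
      gradC n * (1 / 2) ^ (β / 2 - 3 / 2) / (1 / 2 - β / 2) * A * ‖h‖ * t ^ (β / 2 - 1 / 2) := by
  have h1 := abs_le_of_abs_deriv_le_rpow (a := β / 2 - 1 / 2)
    (A := gradC n * (1 / 2) ^ (β / 2 - 3 / 2) * A * ‖h‖)
    (f := fun t => heatSemigroup t u (x + h) - heatSemigroup t u x)
    (f' := fun t => heatDeriv 1 u t (x + h) - heatDeriv 1 u t x) (by linarith) ?_ ?_ ?_ ht
  · refine h1.trans_eq ?_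
    rw [neg_sub]
    ring
  · intro r hr
    have hd : ∀ y, HasDerivAt (fun r => heatSemigroup r u y) (heatDeriv 1 u r y) r := fun y => by
      have := hu.hasDerivAt_heatDeriv 0 hr y
      simpa only [heatDeriv_zero] using this
    exact (hd (x + h)).sub (hd x)
  · intro r hr
    have hr2 := half_pos hr
    rw [heatDeriv_half hu 1 hr]
    refine ((hA.bm hu hr2).abs_heatSemigroup_sub_le hr2 x h).trans_eq ?_
    rw [Nat.cast_one, div_sqrt_eq hr2, show β / 2 - 1 / 2 - 1 = -(1 / 2) + (β / 2 - 1) by ring,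
      show β / 2 - 3 / 2 = -(1 / 2) + (β / 2 - 1) by ring]
    linear_combination gradC n * ‖h‖ * A * (div_two_rpow (a := -(1 / 2) + (β / 2 - 1)) hr -
      Real.rpow_add hr2 (-(1 / 2)) (β / 2 - 1))
  · refine squeeze_zero_norm' (a := fun t => gradC n / Real.sqrt t * ‖h‖ * M) ?_ ?_
    · filter_upwards [eventually_gt_atTop 0] with r hr
      exact hu.abs_heatSemigroup_sub_le hr x h
    · have : Tendsto (fun t : ℝ => gradC n / Real.sqrt t * ‖h‖ * M) atTop
          (𝓝 (0 * ‖h‖ * M)) :=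
        ((Tendsto.const_div_atTop Real.tendsto_sqrt_atTop _).mul_const _).mul_const _
      simpa using this

/-! ### The case `0 < β ≤ 1` -/

/-- `|w(x + h) - w(x)| ≤ N |h|^β`. -/
def HolderBound (β : ℝ) (w : E n → ℝ) (N : ℝ) : Prop := ∀ x h, |w (x + h) - w x| ≤ N * ‖h‖ ^ β

/-- `|w(x + h) + w(x - h) - 2w(x)| ≤ N |h|^β`. -/
def ZygmundBound (β : ℝ) (w : E n → ℝ) (N : ℝ) : Prop := ∀ x h, |secondDiff w h x| ≤ N * ‖h‖ ^ β

lemma HolderBound.zygmund {β N : ℝ} {w : E n → ℝ} (hw : HolderBound β w N) :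
    ZygmundBound β w (2 * N) := by
  intro x h
  have h1 := hw x h
  have h2 := hw x (-h)
  rw [norm_neg, ← sub_eq_add_neg] at h2
  have : secondDiff w h x = (w (x + h) - w x) + (w (x - h) - w x) := by
    rw [secondDiff]
    ring
  rw [this]
  refine (abs_add_le _ _).trans ?_
  linarith

/-- `t^{α/2-1}` is integrable at `0`, so `e^{tΔ}u` converges uniformly. The limit is continuous and,
being also the distributional limit, is a representative of `u`. -/
lemma HeatBound.exists_limit {u : E n → ℝ} {M A α : ℝ} (hα : 0 < α) (hA : HeatBound α 1 u A)
    (hu : BM u M) : ∃ v : E n → ℝ, Continuous v ∧ u =ᵐ[volume] v ∧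
      ∀ t x, 0 < t → |heatSemigroup t u x - v x| ≤ A / (α / 2) * t ^ (α / 2) := by
  obtain ⟨v, hv⟩ := exists_limit_of_holder_in_time (f := fun t => heatSemigroup t u)
    (A := A / (α / 2)) (a := α / 2) (by positivity) (fun s t x hs hst => by
      refine abs_sub_le_of_abs_deriv_le (f := fun t => heatSemigroup t u x)
        (g := fun t => A / (α / 2) * t ^ (α / 2)) (f' := fun t => heatDeriv 1 u t x) hst
        (fun r hr => ?_)
        (fun r hr => hasDerivAt_rpow_const_mul (by positivity) (hs.trans_le hr.1))
        (fun r hr => by simpa using hA x r (hs.trans_le hr.1))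
      have := hu.hasDerivAt_heatDeriv 0 (hs.trans_le hr.1) x
      simpa only [heatDeriv_zero] using this)
  have hA0 := hA.nonneg
  have hr : Tendsto (fun t : ℝ => A / (α / 2) * t ^ (α / 2)) (𝓝[>] 0) (𝓝 0) :=
    (tendsto_const_mul_rpow_zero _ (by positivity)).mono_left nhdsWithin_le_nhds
  have hc : Continuous v := by
    have hU : TendstoUniformly (fun t => heatSemigroup t u) v (𝓝[>] 0) := by
      rw [Metric.tendstoUniformly_iff]
      intro ε hε
      filter_upwards [self_mem_nhdsWithin, hr.eventually (gt_mem_nhds hε)] with t ht ht2 x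
      rw [dist_comm, dist_eq_norm]
      exact (hv t x ht).trans_lt ht2
    refine hU.continuous (Eventually.frequently ?_)
    filter_upwards [self_mem_nhdsWithin] with t ht
    exact hu.continuous_heatSemigroup ht
  exact ⟨v, hc, hu.ae_eq_of_limit (by positivity) hv hc, hv⟩

lemma sq_rpow_half {r a : ℝ} (hr : 0 ≤ r) : (r ^ 2) ^ a = r ^ (2 * a) := by
  rw [Real.rpow_mul hr, Real.rpow_two]

/-- Decay gives Zygmund and Hölder regularity, for `0 < β ≤ 1`. -/
lemma HeatBound.exists_zygmund (n : ℕ) {β : ℝ} (hβ : 0 < β) (hβ1 : β ≤ 1) : ∃ C : ℝ, 0 ≤ C ∧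
    ∀ (u : E n → ℝ) (M A : ℝ), BM u M → HeatBound β 1 u A →
      ∃ v : E n → ℝ, Continuous v ∧ u =ᵐ[volume] v ∧ ZygmundBound β v (C * A) ∧
        (β < 1 → HolderBound β v (C * A)) := by
  have hg := gradC_nonneg n
  have hβ2 : 0 < 1 - β / 2 := by linarith
  set C1 := 4 * gradC n ^ 2 * (1 / 2) ^ (β / 2 - 1) / (1 - β / 2) with hC1
  set C2 := gradC n * (1 / 2) ^ (β / 2 - 3 / 2) / (1 / 2 - β / 2) with hC2
  have hC1' : 0 ≤ C1 := by positivity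
  -- At `β = 1` the denominator is zero and `C2 = 0` by convention; `C2` matters only for the Hölder
  -- bound, where `β < 1`.
  have hC2' : 0 ≤ C2 := div_nonneg (by positivity) (by linarith)
  refine ⟨4 * (1 / (β / 2)) + C1 + C2, by positivity, fun u M A hu hA => ?_⟩
  have hA0 := hA.nonneg
  obtain ⟨v, hvc, huv, hv⟩ := hA.exists_limit hβ hu
  -- The choice `t = |h|²` balances the error of replacing `v` by `e^{tΔ}u` against the differences
  -- of `e^{tΔ}u`. A second difference makes this replacement with total weight `1 + 1 + 2`, hence
  -- the `4` in the constant.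
  have hsq : ∀ h : E n, h ≠ 0 → ∀ x, |heatSemigroup (‖h‖ ^ 2) u x - v x| ≤
      1 / (β / 2) * A * ‖h‖ ^ β := by
    intro h hh x
    have := hv (‖h‖ ^ 2) x (by positivity)
    rw [sq_rpow_half (norm_nonneg _)] at this
    refine this.trans_eq ?_
    rw [show 2 * (β / 2) = β by ring]
    ring
  refine ⟨v, hvc, huv, fun x h => ?_, fun hβ1 x h => ?_⟩
  · rcases eq_or_ne h 0 with rfl | hh
    · have : secondDiff v 0 x = 0 := by simp [secondDiff]; ring
      rw [this, abs_zero]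
      positivity
    have hh0 : 0 < ‖h‖ := norm_pos_iff.2 hh
    have h1 := hA.abs_secondDiff_heatSemigroup_le (by linarith) hu h x
      (t := ‖h‖ ^ 2) (by positivity)
    have h2 : ‖h‖ ^ 2 * (‖h‖ ^ 2) ^ (β / 2 - 1) = ‖h‖ ^ β := by
      rw [sq_rpow_half (norm_nonneg _), ← Real.rpow_two, ← Real.rpow_add hh0]
      congr 1
      ring
    rw [← hC1, mul_assoc (C1 * A), h2] at h1
    have e1 := hsq h hh (x + h)
    have e2 := hsq h hh (x - h)
    have e3 := hsq h hh x
    have e4 : 0 ≤ C2 * A * ‖h‖ ^ β := by positivity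
    have h3 : (4 * (1 / (β / 2)) + C1 + C2) * A * ‖h‖ ^ β = 4 * (1 / (β / 2) * A * ‖h‖ ^ β) +
        C1 * A * ‖h‖ ^ β + C2 * A * ‖h‖ ^ β := by ring
    rw [h3]
    simp only [secondDiff] at h1 ⊢
    rw [abs_le] at *
    constructor <;> linarith
  · rcases eq_or_ne h 0 with rfl | hh
    · rw [add_zero, sub_self, abs_zero]
      positivity
    have hh0 : 0 < ‖h‖ := norm_pos_iff.2 hh
    have h1 := hA.abs_sub_heatSemigroup_le hβ1 hu h x (t := ‖h‖ ^ 2) (by positivity)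
    have h2 : ‖h‖ * (‖h‖ ^ 2) ^ (β / 2 - 1 / 2) = ‖h‖ ^ β := by
      rw [sq_rpow_half (norm_nonneg _)]
      nth_rewrite 1 [← Real.rpow_one ‖h‖]
      rw [← Real.rpow_add hh0]
      congr 1
      ring
    rw [← hC2, mul_assoc (C2 * A), h2] at h1
    have e1 := hsq h hh (x + h)
    have e3 := hsq h hh x
    have e4 : 0 ≤ C1 * A * ‖h‖ ^ β := by positivity
    have e5 : 0 ≤ 1 / (β / 2) * A * ‖h‖ ^ β := by positivity
    have h3 : (4 * (1 / (β / 2)) + C1 + C2) * A * ‖h‖ ^ β = 4 * (1 / (β / 2) * A * ‖h‖ ^ β) +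
        C1 * A * ‖h‖ ^ β + C2 * A * ‖h‖ ^ β := by ring
    rw [h3]
    rw [abs_le] at *
    constructor <;> linarith

/-! ### From Zygmund regularity to decay, for small exponents. -/

/-- The integral is the time derivative of `e^{tΔ}1 = 1`. -/
lemma integral_timeKernel {t : ℝ} (ht : 0 < t) : ∫ z, timeKernel n t z = 0 := by
  have h1 : BM (fun _ : E n => (1 : ℝ)) 1 := .of_le aestronglyMeasurable_const (by simp)
  have h2 := h1.hasDerivAt_heatSemigroup ht 0
  have h3 : (fun s => heatSemigroup s (fun _ : E n => (1 : ℝ)) 0) =ᶠ[𝓝 t] fun _ => 1 := by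
    filter_upwards [lt_mem_nhds ht] with s hs
    rw [heatSemigroup_eq_conv]
    simp [conv, integral_heatKernel hs]
  have h4 := h2.unique ((hasDerivAt_const t (1 : ℝ)).congr_of_eventuallyEq h3)
  simpa [conv] using h4

lemma timeKernel_neg (t : ℝ) (z : E n) : timeKernel n t (-z) = timeKernel n t z := by
  simp [timeKernel, heatKernel_neg]

/-- Zygmund regularity gives decay. -/
lemma ZygmundBound.heatBound {β N M : ℝ} (hβ : 0 < β) (hβ2 : β ≤ 2) {v : E n → ℝ}
    (hN : 0 ≤ N) (hv : ZygmundBound β v N) (hb : BM v M) : HeatBound β 1 v (17 * timeC n * kc n * N) := by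
  intro x t ht
  have hT := timeC_nonneg n
  have i0 := integrable_timeKernel (n := n) ht
  have i1 : Integrable fun z => timeKernel n t z * v (x - z) := BM.integrable_mul i0 (hb.comp_sub_left x)
  have i2 : Integrable fun z => timeKernel n t z * v (x + z) := by
    have := i1.comp_neg
    simpa [timeKernel_neg] using this
  have e2 : ∫ z, timeKernel n t z * v (x + z) = ∫ z, timeKernel n t z * v (x - z) := by
    rw [← integral_neg_eq_self]
    simp [timeKernel_neg, sub_eq_add_neg]
  -- Evenness of `∂_t G_t` symmetrises `v(x - z)`, and its zero mean allows `2 v(x)` to be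
  -- subtracted.
  have e1 : 2 * heatDeriv 1 v t x = ∫ z, timeKernel n t z * secondDiff v z x := by
    have : ∀ z, timeKernel n t z * secondDiff v z x = timeKernel n t z * v (x + z) +
        timeKernel n t z * v (x - z) - timeKernel n t z * (2 * v x) := by
      intro z
      rw [secondDiff]
      ring
    simp_rw [this]
    rw [integral_sub (f := fun z => timeKernel n t z * v (x + z) + timeKernel n t z * v (x - z))
      (i2.add i1) (i0.mul_const _), integral_add i2 i1, e2, integral_mul_const,
      integral_timeKernel ht, hb.heatDeriv_one ht, conv]
    ring
  -- Since `β ≤ 2`, `|z|^β ≤ t^{β/2}(1 + |z|²/t)`, and doubling the time once more absorbs the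
  -- quadratic factor. The constant is `17 = 1 + 2 · 8`.
  have hpt : ∀ z : E n, ‖timeKernel n t z * secondDiff v z x‖ ≤
      timeC n / t * N * t ^ (β / 2) * (17 * kc n) * heatKernel n (2 * (2 * t)) z := by
    intro z
    have k1 := sq_norm_mul_heatKernel_le (t := 2 * t) (by positivity) z
    have k2 := heatKernel_le_two (t := 2 * t) (by positivity) z
    have k3 := (heatKernel_pos (t := 2 * t) (by positivity) z).le
    have h1 : ‖z‖ ^ β ≤ t ^ (β / 2) * (1 + ‖z‖ ^ 2 / t) := by
      have h2 : ‖z‖ ^ β = t ^ (β / 2) * (‖z‖ ^ 2 / t) ^ (β / 2) := by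
        rw [← Real.mul_rpow ht.le (by positivity), mul_div_cancel₀ _ ht.ne',
          sq_rpow_half (norm_nonneg _)]
        congr 1
        ring
      rw [h2]
      gcongr
      have h3 : 0 ≤ ‖z‖ ^ 2 / t := by positivity
      rcases le_total (‖z‖ ^ 2 / t) 1 with h4 | h4
      · linarith [Real.rpow_le_one h3 h4 (by positivity : 0 ≤ β / 2)]
      · have := Real.rpow_le_rpow_of_exponent_le h4 (by linarith : β / 2 ≤ 1)
        rw [Real.rpow_one] at this
        linarith
    calc ‖timeKernel n t z * secondDiff v z x‖
        = |timeKernel n t z| * |secondDiff v z x| := norm_mul _ _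
      _ ≤ (timeC n / t * heatKernel n (2 * t) z) * (N * (t ^ (β / 2) * (1 + ‖z‖ ^ 2 / t))) := by
        refine mul_le_mul (abs_timeKernel_le ht z) ((hv x z).trans ?_) (abs_nonneg _) (by positivity)
        gcongr
      _ = timeC n / t * N * t ^ (β / 2) * (heatKernel n (2 * t) z +
          2 * (‖z‖ ^ 2 / (2 * t) * heatKernel n (2 * t) z)) := by field_simp
      _ ≤ timeC n / t * N * t ^ (β / 2) * (17 * kc n * heatKernel n (2 * (2 * t)) z) := by
        gcongr
        linarith
      _ = _ := by ring
  have h4 := norm_integral_le_of_norm_le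
    ((integrable_heatKernel (n := n) (t := 2 * (2 * t)) (by positivity)).const_mul
      (timeC n / t * N * t ^ (β / 2) * (17 * kc n))) (ae_of_all _ hpt)
  rw [← e1, integral_const_mul, integral_heatKernel (by positivity), mul_one, Real.norm_eq_abs,
    abs_mul, abs_two] at h4
  have h5 : timeC n / t * N * t ^ (β / 2) * (17 * kc n) =
      17 * timeC n * kc n * N * t ^ (β / 2 - (1 : ℕ)) := by
    rw [Nat.cast_one, Real.rpow_sub_one ht.ne']
    ring
  rw [h5] at h4
  linarith [abs_nonneg (heatDeriv 1 v t x)]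

/-! ### Directional derivatives and the heat semigroup -/

lemma hasLineDerivAt_conv {K v w : E n → ℝ} {M N : ℝ} {e : E n} (hK : Integrable K) (hv : BM v M)
    (hw : AEStronglyMeasurable w volume) (hN : ∀ x, |w x| ≤ N)
    (hd : ∀ x, HasLineDerivAt ℝ v (w x) x e) (x : E n) :
    HasLineDerivAt ℝ (conv K v) (conv K w x) x e := by
  have h0 := (hasDerivAt_integral_of_dominated_loc_of_deriv_le (bound := fun z => ‖K z‖ * N)
    (s := Set.univ) (x₀ := (0 : ℝ)) (μ := volume) (F := fun r z => K z * v (x + r • e - z)) univ_mem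
    (Eventually.of_forall fun r => hK.aestronglyMeasurable.mul (hv.comp_sub_left _).aesm)
    (BM.integrable_mul hK (hv.comp_sub_left _)) (F' := fun r z => K z * w (x + r • e - z))
    (hK.aestronglyMeasurable.mul
      (hw.comp_quasiMeasurePreserving (quasiMeasurePreserving_sub_left volume _)))
    (ae_of_all _ fun z r _ => ?_) (hK.norm.mul_const N) (ae_of_all _ fun z r _ => ?_)).2
  · simpa only [HasLineDerivAt, zero_smul, add_zero] using! h0
  · rw [norm_mul]
    exact mul_le_mul_of_nonneg_left (hN _) (norm_nonneg _)
  · have h1 : HasDerivAt (fun r' => v (x + r • e - z + r' • e)) (w (x + r • e - z)) (r - r) := by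
      rw [sub_self]
      exact hd _
    have h2 := (h1.comp_sub_const r r).const_mul (K z)
    convert! h2 using 1
    funext r'
    rw [sub_smul]
    congr 2
    abel

lemma hasLineDerivAt_heatDeriv {v w : E n → ℝ} {M N : ℝ} {e : E n} (hv : BM v M)
    (hw : AEStronglyMeasurable w volume) (hN : ∀ x, |w x| ≤ N)
    (hd : ∀ x, HasLineDerivAt ℝ v (w x) x e) (k : ℕ) {t : ℝ} (ht : 0 < t) (x : E n) :
    HasLineDerivAt ℝ (heatDeriv k v t) (heatDeriv k w t x) x e := by
  have hwb : BM w N := .of_le hw hN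
  induction k generalizing t x with
  | zero =>
    rw [heatDeriv_zero, heatDeriv_zero, heatSemigroup_eq_conv, heatSemigroup_eq_conv]
    exact hasLineDerivAt_conv (integrable_heatKernel ht) hv hw hN hd x
  | succ k ih =>
    have ht2 := half_pos ht
    have h1 := hv.heatDeriv_succ k ht2 ht2
    have h2 := hwb.heatDeriv_succ k ht2 ht2
    rw [add_halves] at h1 h2
    rw [h1, h2]
    exact hasLineDerivAt_conv (integrable_timeKernel ht2) (hv.heatDeriv k ht2)
      (hwb.heatDeriv k ht2).aesm (hwb.abs_heatDeriv_le k ht2) (fun y => ih ht2 y) x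

lemma hasFDerivAt_heatDeriv {v : E n → ℝ} {M s t : ℝ} (hv : BM v M) (k : ℕ) (hs : 0 < s)
    (ht : 0 < t) (x : E n) :
    HasFDerivAt (heatDeriv k v (s + t)) (heatGrad s (heatDeriv k v t) x) x := by
  rw [hv.heatDeriv_add k hs ht]
  exact (hv.heatDeriv k ht).hasFDerivAt_heatSemigroup hs x

/-- The derivative along `e` may fall on the kernel or on the function; uniqueness of derivatives
identifies the results. This exchange transfers decay between `v` and its derivatives. -/
lemma heatDeriv_lineDeriv_eq {v w : E n → ℝ} {M N : ℝ} {e : E n} (hv : BM v M)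
    (hw : AEStronglyMeasurable w volume) (hN : ∀ x, |w x| ≤ N)
    (hd : ∀ x, HasLineDerivAt ℝ v (w x) x e) (k : ℕ) {s t : ℝ} (hs : 0 < s) (ht : 0 < t) (x : E n) :
    heatGrad s (heatDeriv k v t) x e = heatDeriv k w (s + t) x :=
  ((hasFDerivAt_heatDeriv hv k hs ht x).hasLineDerivAt e).unique
    (hasLineDerivAt_heatDeriv hv hw hN hd k (add_pos hs ht) x)

/-- A directional derivative lowers the exponent by one. -/
lemma HeatBound.lineDeriv {v w : E n → ℝ} {M N A α : ℝ} {k : ℕ} {e : E n} (hA : HeatBound α k v A)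
    (hv : BM v M) (hw : AEStronglyMeasurable w volume) (hN : ∀ x, |w x| ≤ N)
    (hd : ∀ x, HasLineDerivAt ℝ v (w x) x e) (he : ‖e‖ ≤ 1) :
    HeatBound (α - 1) k w (gradC n * (1 / 2) ^ ((α - 1) / 2 - k) * A) := by
  intro x t ht
  have ht2 := half_pos ht
  have h1 := heatDeriv_lineDeriv_eq hv hw hN hd k ht2 ht2 x
  have hg := gradC_nonneg n
  have hA0 := hA.nonneg
  rw [add_halves] at h1
  rw [← h1]
  calc |heatGrad (t / 2) (heatDeriv k v (t / 2)) x e|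
      ≤ ‖heatGrad (t / 2) (heatDeriv k v (t / 2)) x‖ * ‖e‖ :=
        (heatGrad (t / 2) (heatDeriv k v (t / 2)) x).le_opNorm e
    _ ≤ (gradC n / Real.sqrt (t / 2) * (A * (t / 2) ^ (α / 2 - k))) * 1 := by
      gcongr
      exact (hA.bm hv ht2).norm_heatGrad_le ht2 x
    _ = _ := by
      rw [div_sqrt_eq ht2, show (α - 1) / 2 - k = -(1 / 2) + (α / 2 - k) by ring]
      linear_combination gradC n * A * (div_two_rpow (a := -(1 / 2) + (α / 2 - k)) ht -
        Real.rpow_add ht2 (-(1 / 2)) (α / 2 - k))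

/-! ### From decay to differentiability -/

/-- Each component of the gradient is `e^{(t/2)Δ}` applied to a bounded function, hence continuous.
-/
lemma BM.continuous_heatGrad {u : E n → ℝ} {M t : ℝ} (hu : BM u M) (ht : 0 < t) :
    Continuous (heatGrad t u) := by
  rw [continuous_clm_apply]
  intro e
  have ht2 := half_pos ht
  have hc : BM (HeatHolder.conv (gradKernel n (t / 2) e) u) _ := hu.conv (integrable_gradKernel ht2 e)
  have : (fun x => heatGrad t u x e) =
      HeatHolder.heatSemigroup (t / 2) (HeatHolder.conv (gradKernel n (t / 2) e) u) := by
    funext x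
    have h1 := (hu.hasFDerivAt_heatSemigroup ht x).hasLineDerivAt e
    have h2 := hasLineDerivAt_conv (integrable_heatKernel ht2) (hu.heatSemigroup ht2) hc.aesm
      (hu.abs_gradConv_le ht2 e) (fun y => by
        rw [← hu.heatGrad_apply ht2]
        exact (hu.hasFDerivAt_heatSemigroup ht2 y).hasLineDerivAt e) x
    have h3 : HeatHolder.heatSemigroup t u =
        HeatHolder.conv (heatKernel n (t / 2)) (HeatHolder.heatSemigroup (t / 2) u) := by
      funext y
      rw [← heatSemigroup_eq_conv, ← hu.heatSemigroup_add ht2 ht2, add_halves]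
    rw [h3] at h1
    rw [heatSemigroup_eq_conv]
    exact h1.unique h2
  rw [this]
  exact hc.continuous_heatSemigroup ht2

lemma heatGrad_add_apply {u : E n → ℝ} {M s t : ℝ} (hu : BM u M) (hs : 0 < s) (ht : 0 < t)
    (x e : E n) : heatGrad (s + t) u x e = conv (gradKernel n s e) (heatSemigroup t u) x := by
  have h1 := hu.hasFDerivAt_heatSemigroup (add_pos hs ht) x
  have h2 := (hu.heatSemigroup ht).hasFDerivAt_heatSemigroup hs x
  have h3 : heatSemigroup (s + t) u = heatSemigroup s (heatSemigroup t u) :=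
    funext fun y => hu.heatSemigroup_add hs ht y
  rw [h3] at h1
  rw [h1.unique h2, (hu.heatSemigroup ht).heatGrad_apply hs]

/-- The gradient kernel is frozen at time `t/2`; only the time of the remaining semigroup factor
varies. -/
lemma hasDerivAt_heatGrad {u : E n → ℝ} {M t : ℝ} (hu : BM u M) (ht : 0 < t) (x e : E n) :
    HasDerivAt (fun t => heatGrad t u x e)
      (conv (gradKernel n (t / 2) e) (heatDeriv 1 u (t / 2)) x) t := by
  have ht2 := half_pos ht
  have hS : Set.Ioi (t / 4) ∈ 𝓝 (t / 2) := Ioi_mem_nhds (by linarith)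
  have hM := hu.nonneg
  have hD := derivC_nonneg n 1
  have h2 := hasDerivAt_conv (integrable_gradKernel ht2 e)
    (w := fun r => heatSemigroup r u) (B := derivC n 1 / (t / 4) ^ 1 * M)
    (w' := fun r => heatDeriv 1 u r) hS
    (fun r hr => (hu.heatSemigroup (lt_trans (by positivity) hr)).aesm) (hu.heatSemigroup ht2)
    (hu.heatDeriv 1 ht2).aesm (fun r hr y => by
      have hr' : t / 4 < r := hr
      refine (hu.abs_heatDeriv_le 1 (lt_trans (by positivity) hr) y).trans ?_
      gcongr)
    (fun r hr y => by
      have := hu.hasDerivAt_heatDeriv 0 (lt_trans (by positivity) hr : 0 < r) y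
      simpa only [heatDeriv_zero] using this) x
  have h3 : HasDerivAt (fun r => conv (gradKernel n (t / 2) e) (heatSemigroup r u) x)
      (conv (gradKernel n (t / 2) e) (heatDeriv 1 u (t / 2)) x) (t - t / 2) := by
    rwa [sub_half]
  refine (h3.comp_sub_const t (t / 2)).congr_of_eventuallyEq ?_
  filter_upwards [lt_mem_nhds (half_lt_self ht)] with r hr
  rw [← heatGrad_add_apply hu ht2 (by linarith), add_sub_cancel]

/-- The gradient has time derivative `O(t^{(α-1)/2-1})`, integrable at `0` exactly because `α > 1`;
so the gradients are uniformly Cauchy as `t → 0`. -/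
lemma HeatBound.norm_heatGrad_sub_le {u : E n → ℝ} {M A α : ℝ} (hα : 1 < α)
    (hA : HeatBound α 1 u A) (hu : BM u M) {s t : ℝ} (hs : 0 < s) (hst : s ≤ t) (x : E n) :
    ‖heatGrad t u x - heatGrad s u x‖ ≤
      gradC n * (1 / 2) ^ ((α - 1) / 2 - 1) * A / ((α - 1) / 2) * t ^ ((α - 1) / 2) -
      gradC n * (1 / 2) ^ ((α - 1) / 2 - 1) * A / ((α - 1) / 2) * s ^ ((α - 1) / 2) := by
  have hA0 := hA.nonneg
  have hg := gradC_nonneg n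
  have ha : 0 < (α - 1) / 2 := by linarith
  refine ContinuousLinearMap.opNorm_le_bound _ ?_ fun e => ?_
  · rw [sub_nonneg]
    gcongr
  have h1 := abs_sub_le_of_abs_deriv_le (f := fun t => heatGrad t u x e)
    (g := fun r => gradC n * (1 / 2) ^ ((α - 1) / 2 - 1) * A * ‖e‖ / ((α - 1) / 2) *
      r ^ ((α - 1) / 2)) hst
    (fun r hr => hasDerivAt_heatGrad hu (hs.trans_le hr.1) x e)
    (fun r hr => hasDerivAt_rpow_const_mul ha.ne' (hs.trans_le hr.1))
    (fun r hr => ?_)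
  · refine h1.trans_eq ?_
    ring
  · have hr0 := hs.trans_le hr.1
    have hr2 := half_pos hr0
    refine ((hA.bm hu hr2).abs_gradConv_le hr2 e x).trans_eq ?_
    rw [div_sqrt_eq hr2, Nat.cast_one, show (α - 1) / 2 - 1 = -(1 / 2) + (α / 2 - 1) by ring]
    linear_combination gradC n * ‖e‖ * A * (div_two_rpow (a := -(1 / 2) + (α / 2 - 1)) hr0 -
      Real.rpow_add hr2 (-(1 / 2)) (α / 2 - 1))

/-- Decay of order `α > 1` gives a continuously differentiable representative whose derivatives
have decay of order `α - 1`. -/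
lemma HeatBound.exists_contDiff_one (n : ℕ) {α : ℝ} (hα : 1 < α) {k : ℕ} : ∃ C : ℝ, 0 ≤ C ∧
    ∀ (u : E n → ℝ) (M A : ℝ), BM u M → HeatBound α k u A →
      ∃ v : E n → ℝ, u =ᵐ[volume] v ∧ Differentiable ℝ v ∧ Continuous (fderiv ℝ v) ∧
        ∀ e : E n, ‖e‖ ≤ 1 → (∀ x, |fderiv ℝ v x e| ≤ C * (M + A)) ∧
          HeatBound (α - 1) k (fun x => fderiv ℝ v x e) (C * (M + A)) := by
  -- The convergence argument uses a single time derivative, which needs `α'/2 < 1`, together with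
  -- `α' > 1`. The full exponent `α` reappears only in the decay of the derivatives, through
  -- `HeatBound.lineDeriv`.
  set α' := min α (3 / 2) with hα'
  have h1α' : 1 < α' := lt_min hα (by norm_num)
  have hα'2 : α' ≤ 3 / 2 := min_le_right _ _
  have ha : 0 < (α' - 1) / 2 := by linarith
  obtain ⟨C₀, hC₀, hred⟩ := HeatBound.reduce n (α := α) (α' := α') (by linarith) (min_le_left _ _)
    (k := k) (l := 1) (by rw [Nat.cast_one]; linarith)
  have hg := gradC_nonneg n
  set D := gradC n * (1 / 2) ^ ((α' - 1) / 2 - 1) * C₀ / ((α' - 1) / 2) with hD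
  have hD0 : 0 ≤ D := by positivity
  set D' := gradC n * (1 / 2) ^ ((α - 1) / 2 - k) with hD'
  have hD'0 : 0 ≤ D' := by positivity
  refine ⟨gradC n + D + D', by positivity, fun u M A hu hA => ?_⟩
  have hM := hu.nonneg
  have hA0 := hA.nonneg
  have hB := hred u M A hu hA
  obtain ⟨v, -, huv, hv⟩ := hB.exists_limit (by linarith) hu
  obtain ⟨g, hg'⟩ := exists_limit_of_holder_in_time (f := fun t => heatGrad t u) ha
    (fun s t x hs hst => hB.norm_heatGrad_sub_le h1α' hu hs hst x)
  have hDA : gradC n * (1 / 2) ^ ((α' - 1) / 2 - 1) * (C₀ * (M + A)) / ((α' - 1) / 2) =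
      D * (M + A) := by
    rw [hD]
    ring
  rw [hDA] at hg'
  have hpow : ∀ (c a : ℝ), 0 < a → Tendsto (fun i : ℕ => c * (1 / ((i : ℝ) + 1)) ^ a) atTop (𝓝 0) :=
    fun c a ha => (tendsto_const_mul_rpow_zero c ha).comp tendsto_one_div_add_atTop_nhds_zero_nat
  have hpos : ∀ i : ℕ, (0 : ℝ) < 1 / ((i : ℝ) + 1) := fun i => by positivity
  have hU : TendstoUniformly (fun i : ℕ => heatGrad (1 / ((i : ℝ) + 1)) u) g atTop := by
    rw [Metric.tendstoUniformly_iff]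
    intro ε hε
    filter_upwards [(hpow (D * (M + A)) _ ha).eventually (gt_mem_nhds hε)] with i hi x
    rw [dist_comm, dist_eq_norm]
    exact (hg' _ x (hpos i)).trans_lt hi
  have hder : ∀ x, HasFDerivAt v (g x) x := by
    refine hasFDerivAt_of_tendstoUniformly hU
      (fun i x => hu.hasFDerivAt_heatSemigroup (hpos i) x) fun x => ?_
    rw [tendsto_iff_norm_sub_tendsto_zero]
    exact squeeze_zero (fun _ => norm_nonneg _) (fun i => hv _ x (hpos i))
      (hpow _ _ (by linarith : 0 < α' / 2))
  have hgc : Continuous g :=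
    hU.continuous (Frequently.of_forall fun i => hu.continuous_heatGrad (hpos i))
  have hfd : fderiv ℝ v = g := funext fun x => (hder x).fderiv
  -- The limit gradient is compared with the gradient at time `1`, which is bounded in terms of `M`.
  have hgn : ∀ x, ‖g x‖ ≤ (gradC n + D) * (M + A) := by
    intro x
    have h1 := hg' 1 x one_pos
    have h2 := hu.norm_heatGrad_le one_pos x
    rw [Real.one_rpow, mul_one] at h1
    rw [Real.sqrt_one, div_one] at h2
    have h3 : ‖g x‖ ≤ ‖heatGrad 1 u x‖ + ‖heatGrad 1 u x - g x‖ := by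
      have := norm_sub_le (heatGrad 1 u x) (heatGrad 1 u x - g x)
      rwa [sub_sub_cancel] at this
    nlinarith [mul_nonneg hg hA0]
  have hga : ∀ e : E n, ‖e‖ ≤ 1 → ∀ x, |g x e| ≤ (gradC n + D) * (M + A) := fun e he x =>
    ((g x).le_opNorm e).trans ((mul_le_of_le_one_right (norm_nonneg _) he).trans (hgn x))
  refine ⟨v, huv, fun x => (hder x).differentiableAt, hfd ▸ hgc, fun e he => ⟨fun x => ?_, ?_⟩⟩
  · rw [hfd]
    exact (hga e he x).trans (mul_le_mul_of_nonneg_right (by linarith) (by positivity))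
  · rw [hfd]
    refine ((hA.congr_ae huv).lineDeriv (hu.congr_ae huv) (by fun_prop) (hga e he)
      (fun x => (hder x).hasLineDerivAt e) he).mono ?_
    have : D' * A ≤ D' * (M + A) := by
      gcongr
      linarith
    have : 0 ≤ (gradC n + D) * (M + A) := by positivity
    linarith

/-! ### From differentiability to decay -/

lemma clm_apply_eq_sum (L : E n →L[ℝ] ℝ) (z : E n) :
    L z = ∑ i, z i * L (EuclideanSpace.single i (1 : ℝ)) := by
  conv_lhs => rw [← (EuclideanSpace.basisFun (Fin n) ℝ).sum_repr z]
  simp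

/-- The heat equation, with one derivative on the function and one on the kernel. -/
lemma heatDeriv_one_eq_sum {f : E n → ℝ} {M N : ℝ} (hf : BM f M) (hd : Differentiable ℝ f)
    (hN : ∀ x, ‖fderiv ℝ f x‖ ≤ N) {t : ℝ} (ht : 0 < t) (x : E n) :
    heatDeriv 1 f t x = ∑ i, conv (gradKernel n t (EuclideanSpace.single i (1 : ℝ)))
      (fun y => fderiv ℝ f y (EuclideanSpace.single i (1 : ℝ))) x := by
  have hN0 : 0 ≤ N := (norm_nonneg _).trans (hN 0)
  have hs : Set.Ioi (t / 4) ∈ 𝓝 t := Ioi_mem_nhds (by linarith)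
  have hst : 0 < Real.sqrt t := Real.sqrt_pos.2 ht
  have hfm : Continuous f := hd.continuous
  have hmeas : ∀ e : E n, Measurable fun y => fderiv ℝ f y e := fun e =>
    measurable_fderiv_apply_const ℝ f e
  have hF1 : Integrable fun y : E n => 9 * kc n * heatKernel n (2 * 1) y * (N * (1 / Real.sqrt t)) :=
    ((integrable_heatKernel (by positivity)).const_mul _).mul_const _
  -- After `z = √s y` the time enters only through `f (x - √s y)`, so the chain rule needs just one
  -- derivative of `f`. Undoing the substitution turns `-y/(2√t)` into `-z/(2t)`, which times `G_t`
  -- is the gradient of `G_t`.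
  have h1 := (hasDerivAt_integral_of_dominated_loc_of_deriv_le (μ := volume) (s := Set.Ioi (t / 4))
    (F := fun s y => heatKernel n 1 y * f (x - Real.sqrt s • y))
    (F' := fun s y => heatKernel n 1 y *
      fderiv ℝ f (x - Real.sqrt s • y) (-((1 / (2 * Real.sqrt s)) • y))) hs ?_ ?_ ?_ ?_ hF1 ?_).2
  · have h2 : (fun s => heatSemigroup s f x) =ᶠ[𝓝 t]
        fun s => ∫ y, heatKernel n 1 y * f (x - Real.sqrt s • y) := by
      filter_upwards [lt_mem_nhds ht] with s hs
      rw [heatSemigroup_eq_conv, conv, integral_heatKernel_mul_scale hs (fun z => f (x - z))]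
    have h3 := hf.hasDerivAt_heatDeriv 0 ht x
    simp only [heatDeriv_zero, zero_add] at h3
    rw [h3.unique (h1.congr_of_eventuallyEq h2)]
    have h4 : ∀ y : E n, -((1 / (2 * Real.sqrt t)) • y) = -((1 / (2 * t)) • (Real.sqrt t • y)) := by
      intro y
      rw [smul_smul]
      congr 2
      nth_rewrite 2 [← Real.mul_self_sqrt ht.le]
      field_simp
    simp_rw [h4]
    rw [← integral_heatKernel_mul_scale ht (fun z => fderiv ℝ f (x - z) (-((1 / (2 * t)) • z)))]
    simp only [conv]
    rw [← integral_finsetSum]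
    · refine integral_congr_ae (ae_of_all _ fun z => ?_)
      simp only
      rw [clm_apply_eq_sum, Finset.mul_sum]
      refine Finset.sum_congr rfl fun i _ => ?_
      simp [gradKernel, EuclideanSpace.inner_single_right]
      ring
    · intro i _
      refine BM.integrable_mul (integrable_gradKernel ht _) (BM.comp_sub_left (M := N * 1)
        (.of_le (hmeas _).aestronglyMeasurable fun y => ?_) x)
      refine ((fderiv ℝ f y).le_opNorm _).trans ?_
      gcongr
      · exact hN y
      · simp
  · exact Eventually.of_forall fun s => ((continuous_heatKernel 1).mul (by fun_prop)).aestronglyMeasurable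
  · exact BM.integrable_mul (integrable_heatKernel one_pos)
      (.of_le (by fun_prop) fun y => hf.abs_le_of_continuous hfm _)
  · refine (continuous_heatKernel 1).aestronglyMeasurable.mul (Measurable.aestronglyMeasurable ?_)
    rw [funext fun y : E n => clm_apply_eq_sum (fderiv ℝ f (x - Real.sqrt t • y))
      (-((1 / (2 * Real.sqrt t)) • y))]
    refine Finset.measurable_fun_sum _ fun i _ => Measurable.mul ?_ ((hmeas _).comp ?_)
    · fun_prop
    · fun_prop
  · refine ae_of_all _ fun y s hs => ?_
    have hs' : t / 4 < s := hs
    have hs0 : 0 < s := lt_trans (by positivity) hs'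
    have hss : Real.sqrt t ≤ 2 * Real.sqrt s := by
      rw [← Real.sqrt_sq zero_le_two, ← Real.sqrt_mul (by norm_num)]
      exact Real.sqrt_le_sqrt (by linarith)
    have h1 := norm_mul_heatKernel_le one_pos y
    rw [Real.sqrt_one, div_one] at h1
    have h0 := (heatKernel_pos one_pos y).le
    rw [norm_mul, Real.norm_of_nonneg h0]
    calc heatKernel n 1 y * ‖fderiv ℝ f (x - Real.sqrt s • y) (-((1 / (2 * Real.sqrt s)) • y))‖
        ≤ heatKernel n 1 y * (N * (1 / Real.sqrt t * ‖y‖)) := by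
          gcongr
          refine ((fderiv ℝ f _).le_opNorm _).trans ?_
          rw [norm_neg, norm_smul, Real.norm_of_nonneg (by positivity)]
          gcongr
          exact hN _
      _ = ‖y‖ * heatKernel n 1 y * (N * (1 / Real.sqrt t)) := by ring
      _ ≤ _ := by gcongr
  · refine ae_of_all _ fun y s hs => ?_
    have hs' : t / 4 < s := hs
    have hs0 : 0 < s := lt_trans (by positivity) hs'
    have h1 := ((Real.hasDerivAt_sqrt hs0.ne').smul_const y).const_sub x
    exact ((hd _).hasFDerivAt.comp_hasDerivAt s h1).const_mul _

/-- If the partial derivatives decay with exponent `α - 1`, the function decays with exponent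
`α`. -/
lemma HeatBound.of_fderiv {v : E n → ℝ} {M N A α : ℝ} {k : ℕ} (hv : BM v M)
    (hd : Differentiable ℝ v)
    (hN : ∀ i x, |fderiv ℝ v x (EuclideanSpace.single i (1 : ℝ))| ≤ N)
    (hA : ∀ i, HeatBound (α - 1) k (fun x => fderiv ℝ v x (EuclideanSpace.single i (1 : ℝ))) A) :
    HeatBound α (k + 1) v (n * (gradC n * (1 / 2) ^ (α / 2 - (k + 1 : ℕ))) * A) := by
  intro x t ht
  have ht2 := half_pos ht
  have ht4 := half_pos ht2
  have hmeas : ∀ e : E n, AEStronglyMeasurable (fun y => fderiv ℝ v y e) volume := fun e =>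
    (measurable_fderiv_apply_const ℝ v e).aestronglyMeasurable
  have hF : ∀ x, HasFDerivAt (heatDeriv k v (t / 2))
      (heatGrad (t / 2 / 2) (heatDeriv k v (t / 2 / 2)) x) x := fun x => by
    have := hasFDerivAt_heatDeriv hv k ht4 ht4 x
    rwa [add_halves] at this
  -- The first `k` time derivatives are taken by time `t/2`; the last one is traded, by the heat
  -- equation, for one derivative on the kernel and one on the function, costing only `t^{-1/2}`.
  have h1 : heatDeriv (k + 1) v t = heatDeriv 1 (heatDeriv k v (t / 2)) (t / 2) := by
    rw [hv.heatDeriv_comp 1 k ht2 ht2, add_halves, add_comm]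
  rw [h1, heatDeriv_one_eq_sum (hv.heatDeriv k ht2) (fun x => (hF x).differentiableAt)
    (fun x => by
      rw [(hF x).fderiv]
      exact (hv.heatDeriv k ht4).norm_heatGrad_le ht4 x) ht2]
  have h2 : ∀ i, (fun y => fderiv ℝ (heatDeriv k v (t / 2)) y (EuclideanSpace.single i (1 : ℝ))) =
      heatDeriv k (fun x => fderiv ℝ v x (EuclideanSpace.single i (1 : ℝ))) (t / 2) := by
    intro i
    funext y
    rw [(hF y).fderiv, heatDeriv_lineDeriv_eq hv (hmeas _) (hN i)
      (fun x => (hd x).hasFDerivAt.hasLineDerivAt _) k ht4 ht4, add_halves]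
  refine (Finset.abs_sum_le_sum_abs _ _).trans ?_
  have h3 : ∀ i ∈ Finset.univ, |conv (gradKernel n (t / 2) (EuclideanSpace.single i (1 : ℝ)))
      (fun y => fderiv ℝ (heatDeriv k v (t / 2)) y (EuclideanSpace.single i (1 : ℝ))) x| ≤
      gradC n * (1 / 2) ^ (α / 2 - (k + 1 : ℕ)) * A * t ^ (α / 2 - (k + 1 : ℕ)) := by
    intro i _
    rw [h2]
    refine (((hA i).bm (.of_le (hmeas _) (hN i)) ht2).abs_gradConv_le ht2 _ x).trans_eq ?_
    rw [div_sqrt_eq ht2, show ‖EuclideanSpace.single i (1 : ℝ)‖ = 1 by simp, mul_one,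
      show α / 2 - (k + 1 : ℕ) = -(1 / 2) + ((α - 1) / 2 - k) by push_cast; ring]
    linear_combination gradC n * A * (div_two_rpow (a := -(1 / 2) + ((α - 1) / 2 - k)) ht -
      Real.rpow_add ht2 (-(1 / 2)) ((α - 1) / 2 - k))
  refine (Finset.sum_le_sum h3).trans_eq ?_
  rw [Finset.sum_const, Finset.card_univ, Fintype.card_fin, nsmul_eq_mul]
  ring

/-! ### Higher derivatives -/

/-- The first-order partial derivative. -/
def partialOne (l : Fin n) (v : E n → ℝ) (x : E n) : ℝ :=
  fderiv ℝ v x (EuclideanSpace.single l (1 : ℝ))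

lemma partialDeriv_zero (i : Fin 0 → Fin n) (v : E n → ℝ) : partialDeriv i v = v := by
  funext x
  simp [partialDeriv]

/-- The last index is the derivative applied first. Peeling it off lets inductions on the order pass
from `v` to its first-order partial derivatives. -/
lemma partialDeriv_succ {j : ℕ} {v : E n → ℝ} (hv : ContDiff ℝ (j + 1 : ℕ) v)
    (i : Fin (j + 1) → Fin n) :
    partialDeriv i v = partialDeriv (Fin.init i) (partialOne (i (Fin.last j)) v) := by
  funext x
  have h1 : ContDiff ℝ j (fderiv ℝ v) := hv.fderiv_right (by norm_cast)
  rw [partialDeriv, iteratedFDeriv_succ_apply_right, partialDeriv]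
  have h2 := iteratedFDeriv_clm_apply_const_apply h1 le_rfl (x := x)
    (u := EuclideanSpace.single (i (Fin.last j)) (1 : ℝ))
    (m := fun l => EuclideanSpace.single (Fin.init i l) (1 : ℝ))
  exact h2.symm

lemma contDiff_partialOne {j : ℕ} {v : E n → ℝ} (hv : ContDiff ℝ (j + 1 : ℕ) v) (l : Fin n) :
    ContDiff ℝ j (partialOne l v) :=
  (hv.fderiv_right (m := j) (by norm_cast)).clm_apply contDiff_const

lemma contDiff_succ_of_partialOne {j : ℕ} {v : E n → ℝ} (hv : Differentiable ℝ v)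
    (h : ∀ l, ContDiff ℝ j (partialOne l v)) : ContDiff ℝ (j + 1 : ℕ) v := by
  push_cast
  rw [contDiff_succ_iff_fderiv]
  refine ⟨hv, by simp, contDiff_clm_apply_iff.2 fun y => ?_⟩
  simp_rw [fun x => clm_apply_eq_sum (fderiv ℝ v x) y]
  exact ContDiff.sum fun i _ => contDiff_const.mul (h i)

/-- All partial derivatives of order at most `m` exist and are bounded by `N`. -/
structure BoundedDerivs (m : ℕ) (v : E n → ℝ) (N : ℝ) : Prop where
  contDiff : ContDiff ℝ m v
  bound : ∀ j ≤ m, ∀ (i : Fin j → Fin n) (x : E n), |partialDeriv i v x| ≤ N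

lemma BoundedDerivs.mono {m : ℕ} {v : E n → ℝ} {N N' : ℝ} (h : BoundedDerivs m v N) (hN : N ≤ N') :
    BoundedDerivs m v N' :=
  ⟨h.contDiff, fun j hj i x => (h.bound j hj i x).trans hN⟩

lemma BoundedDerivs.abs_le {m : ℕ} {v : E n → ℝ} {N : ℝ} (h : BoundedDerivs m v N) (x : E n) :
    |v x| ≤ N := by
  have := h.bound 0 (Nat.zero_le _) Fin.elim0 x
  rwa [partialDeriv_zero] at this

lemma BoundedDerivs.nonneg {m : ℕ} {v : E n → ℝ} {N : ℝ} (h : BoundedDerivs m v N) : 0 ≤ N :=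
  (abs_nonneg _).trans (h.abs_le 0)

lemma BoundedDerivs.bm {m : ℕ} {v : E n → ℝ} {N : ℝ} (h : BoundedDerivs m v N) : BM v N :=
  .of_le h.contDiff.continuous.aestronglyMeasurable h.abs_le

lemma BoundedDerivs.partialDeriv_snoc {m : ℕ} {v : E n → ℝ} {N : ℝ}
    (h : BoundedDerivs (m + 1) v N) {j : ℕ} (hj : j ≤ m) (l : Fin n) (i : Fin j → Fin n) :
    partialDeriv i (partialOne l v) = partialDeriv (Fin.snoc i l : Fin (j + 1) → Fin n) v := by
  rw [partialDeriv_succ (h.contDiff.of_le (by exact_mod_cast Nat.succ_le_succ hj)), Fin.init_snoc,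
    Fin.snoc_last]

lemma BoundedDerivs.partialOne {m : ℕ} {v : E n → ℝ} {N : ℝ} (h : BoundedDerivs (m + 1) v N)
    (l : Fin n) : BoundedDerivs m (partialOne l v) N :=
  ⟨contDiff_partialOne h.contDiff l, fun j hj i x => by
    rw [h.partialDeriv_snoc hj]
    exact h.bound _ (Nat.succ_le_succ hj) _ _⟩

lemma ZygmundBound.mono {β N N' : ℝ} {w : E n → ℝ} (h : ZygmundBound β w N) (hN : N ≤ N') :
    ZygmundBound β w N' := fun x y =>
  (h x y).trans (mul_le_mul_of_nonneg_right hN (by positivity))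

lemma HolderBound.mono {β N N' : ℝ} {w : E n → ℝ} (h : HolderBound β w N) (hN : N ≤ N') :
    HolderBound β w N' := fun x y =>
  (h x y).trans (mul_le_mul_of_nonneg_right hN (by positivity))

lemma ZygmundBound.heatBound_order (n : ℕ) {β : ℝ} (hβ : 0 < β) (hβ1 : β ≤ 1) {k : ℕ}
    (hk : β / 2 < k) : ∃ C : ℝ, 0 ≤ C ∧ ∀ (v : E n → ℝ) (M N : ℝ), BM v M → 0 ≤ N →
      ZygmundBound β v N → HeatBound β k v (C * N) := by
  obtain ⟨C, hC, h⟩ := HeatBound.change n hβ (k := 1) hk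
  have := timeC_nonneg n
  have := (kc_pos n).le
  refine ⟨C * (17 * timeC n * kc n), by positivity, fun v M N hv hN hz => ?_⟩
  rw [mul_assoc]
  exact h v M _ hv (hz.heatBound hβ (by linarith) hN hv)

/-- Regularity of order `m + β` gives decay. -/
lemma BoundedDerivs.heatBound (n m : ℕ) {β : ℝ} (hβ : 0 < β) (hβ1 : β ≤ 1) {k : ℕ}
    (hk : (m + β) / 2 < k) : ∃ C : ℝ, 0 ≤ C ∧ ∀ (v : E n → ℝ) (N : ℝ), BoundedDerivs m v N →
      (∀ i : Fin m → Fin n, ZygmundBound β (partialDeriv i v) N) →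
      HeatBound (m + β) k v (C * N) := by
  induction m with
  | zero =>
    rw [Nat.cast_zero, zero_add] at *
    obtain ⟨C, hC, h⟩ := ZygmundBound.heatBound_order n hβ hβ1 hk
    refine ⟨C, hC, fun v N hv hz => h v N N hv.bm hv.nonneg ?_⟩
    have := hz Fin.elim0
    rwa [partialDeriv_zero] at this
  | succ m ih =>
    push_cast at hk
    obtain ⟨C, hC, h⟩ := ih (by linarith)
    -- `HeatBound.of_fderiv` raises the order to `k + 1`; this brings it back to `k`.
    obtain ⟨C₁, hC₁, h₁⟩ := HeatBound.change n (α := (m + 1 : ℕ) + β) (by positivity) (k := k + 1)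
      (l := k) (by push_cast; linarith)
    have hg := gradC_nonneg n
    refine ⟨C₁ * ((n * (gradC n * (1 / 2) ^ (((m + 1 : ℕ) + β) / 2 - (k + 1 : ℕ)))) * C),
      by positivity, fun v N hv hz => ?_⟩
    rw [mul_assoc, mul_assoc _ C]
    refine h₁ v N _ hv.bm (HeatBound.of_fderiv hv.bm
      (hv.contDiff.differentiable (by simp)) (fun i => (hv.partialOne i).abs_le) fun i => ?_)
    have hα : ((m + 1 : ℕ) : ℝ) + β - 1 = m + β := by push_cast; ring
    rw [hα]
    refine h _ N (hv.partialOne i) fun i' => ?_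
    have := hz (Fin.snoc i' i : Fin (m + 1) → Fin n)
    rwa [← hv.partialDeriv_snoc le_rfl] at this

/-- Decay gives regularity of order `m + β`. -/
lemma HeatBound.exists_boundedDerivs (n m : ℕ) {β : ℝ} (hβ : 0 < β) (hβ1 : β ≤ 1) {k : ℕ} :
    ∃ C : ℝ, 0 ≤ C ∧ ∀ (u : E n → ℝ) (M A : ℝ), BM u M → HeatBound (m + β) k u A →
      ∃ v : E n → ℝ, u =ᵐ[volume] v ∧ BoundedDerivs m v (C * (M + A)) ∧
        ∀ i : Fin m → Fin n, ZygmundBound β (partialDeriv i v) (C * (M + A)) ∧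
          (β < 1 → HolderBound β (partialDeriv i v) (C * (M + A))) := by
  induction m with
  | zero =>
    obtain ⟨C₁, hC₁, h₁⟩ := HeatBound.change n hβ (k := k) (l := 1) (by rw [Nat.cast_one]; linarith)
    obtain ⟨C₂, hC₂, h₂⟩ := HeatBound.exists_zygmund n hβ hβ1
    refine ⟨1 + C₂ * C₁, by positivity, fun u M A hu hA => ?_⟩
    rw [Nat.cast_zero, zero_add] at hA
    obtain ⟨v, hvc, huv, hz, hh⟩ := h₂ u M _ hu (h₁ u M A hu hA)
    have hM := hu.nonneg
    have hA0 := hA.nonneg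
    have hle : C₂ * (C₁ * A) ≤ (1 + C₂ * C₁) * (M + A) := by
      nlinarith [mul_nonneg (mul_nonneg hC₂ hC₁) hM]
    refine ⟨v, huv, ⟨contDiff_zero.2 hvc, fun j hj i x => ?_⟩, fun i => ?_⟩
    · obtain rfl : j = 0 := Nat.le_zero.1 hj
      rw [partialDeriv_zero]
      refine ((hu.congr_ae huv).abs_le_of_continuous hvc x).trans ?_
      nlinarith [mul_nonneg (mul_nonneg hC₂ hC₁) hM, mul_nonneg (mul_nonneg hC₂ hC₁) hA0]
    · rw [partialDeriv_zero]
      exact ⟨hz.mono hle, fun h => (hh h).mono hle⟩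
  | succ m ih =>
    obtain ⟨C₁, hC₁, h₁⟩ := HeatBound.exists_contDiff_one n (α := (m + 1 : ℕ) + β)
      (by push_cast; linarith [m.cast_nonneg (α := ℝ)]) (k := k)
    obtain ⟨C₂, hC₂, h₂⟩ := ih
    refine ⟨1 + C₂ * (2 * C₁), by positivity, fun u M A hu hA => ?_⟩
    have hM := hu.nonneg
    have hA0 := hA.nonneg
    obtain ⟨v, huv, hd, hdc, hv⟩ := h₁ u M A hu hA
    -- A partial derivative has both its sup bound and its decay constant equal to `C₁ (M + A)`,
    -- hence `2 * C₁`.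
    have hle : C₂ * (C₁ * (M + A) + C₁ * (M + A)) ≤ (1 + C₂ * (2 * C₁)) * (M + A) := by
      nlinarith
    have hα : ((m + 1 : ℕ) : ℝ) + β - 1 = m + β := by push_cast; ring
    have hl : ∀ l, BoundedDerivs m (partialOne l v) ((1 + C₂ * (2 * C₁)) * (M + A)) ∧
        ∀ i : Fin m → Fin n,
          ZygmundBound β (partialDeriv i (partialOne l v)) ((1 + C₂ * (2 * C₁)) * (M + A)) ∧
          (β < 1 →
            HolderBound β (partialDeriv i (partialOne l v)) ((1 + C₂ * (2 * C₁)) * (M + A))) := by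
      intro l
      obtain ⟨hb, hH⟩ := hv (EuclideanSpace.single l (1 : ℝ)) (by simp)
      rw [hα] at hH
      have hc : Continuous (partialOne l v) := hdc.clm_apply continuous_const
      obtain ⟨w, hw, hwb, hwz⟩ := h₂ (partialOne l v) _ _ (.of_le hc.aestronglyMeasurable hb) hH
      -- The representative from the induction hypothesis is the partial derivative itself, since
      -- both are continuous.
      obtain rfl : partialOne l v = w := (hc.ae_eq_iff_eq volume hwb.contDiff.continuous).1 hw
      exact ⟨hwb.mono hle, fun i => ⟨(hwz i).1.mono hle, fun h => ((hwz i).2 h).mono hle⟩⟩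
    have hcd : ContDiff ℝ (m + 1 : ℕ) v := contDiff_succ_of_partialOne hd fun l => (hl l).1.contDiff
    refine ⟨v, huv, ⟨hcd, fun j hj i x => ?_⟩, fun i => ?_⟩
    · cases j with
      | zero =>
        rw [partialDeriv_zero]
        refine ((hu.congr_ae huv).abs_le_of_continuous hd.continuous x).trans ?_
        have : 0 ≤ C₂ * (2 * C₁) * (M + A) := by positivity
        linarith
      | succ j =>
        rw [partialDeriv_succ (hcd.of_le (by exact_mod_cast hj))]
        exact (hl _).1.bound j (Nat.le_of_succ_le_succ hj) _ _
    · rw [partialDeriv_succ hcd]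
      exact (hl _).2 _

/-! ### Extended norms -/

lemma enorm_le_of_abs_le {a b : ℝ} (h : |a| ≤ b) : ‖a‖ₑ ≤ ENNReal.ofReal b := by
  rw [Real.enorm_eq_ofReal_abs]
  exact ENNReal.ofReal_le_ofReal h

lemma abs_le_toReal_of_enorm_le {a : ℝ} {b : ℝ≥0∞} (hb : b < ∞) (h : ‖a‖ₑ ≤ b) : |a| ≤ b.toReal := by
  rw [Real.enorm_eq_ofReal_abs] at h
  exact (ENNReal.ofReal_le_iff_le_toReal hb.ne).1 h

lemma HeatBound.heatSeminorm_le {α A : ℝ} {k : ℕ} {u : E n → ℝ} (h : HeatBound α k u A) :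
    heatSeminorm α k u ≤ ENNReal.ofReal A := by
  refine iSup_le fun x => iSup_le fun t => iSup_le fun ht => enorm_le_of_abs_le ?_
  have h1 : t ^ ((k : ℝ) - α / 2) * t ^ (α / 2 - k) = 1 := by
    rw [← Real.rpow_add ht]
    simp
  rw [abs_mul, abs_of_pos (by positivity : 0 < t ^ ((k : ℝ) - α / 2))]
  calc _ ≤ t ^ ((k : ℝ) - α / 2) * (A * t ^ (α / 2 - k)) := by
        gcongr
        exact h x t ht
    _ = A * (t ^ ((k : ℝ) - α / 2) * t ^ (α / 2 - k)) := by ring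
    _ = A := by rw [h1, mul_one]

lemma heatBound_of_heatSeminorm_lt_top {α : ℝ} {k : ℕ} {u : E n → ℝ}
    (h : heatSeminorm α k u < ∞) : HeatBound α k u (heatSeminorm α k u).toReal := by
  intro x t ht
  have h1 : ‖t ^ ((k : ℝ) - α / 2) * heatDeriv k u t x‖ₑ ≤ heatSeminorm α k u :=
    le_iSup_of_le x (le_iSup_of_le t (le_iSup_of_le ht le_rfl))
  have h2 := abs_le_toReal_of_enorm_le h h1
  rw [abs_mul, abs_of_pos (by positivity : 0 < t ^ ((k : ℝ) - α / 2))] at h2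
  rw [← neg_sub, Real.rpow_neg ht.le, ← div_eq_mul_inv, le_div_iff₀ (by positivity), mul_comm]
  exact h2

lemma bm_of_eLpNorm_lt_top {u : E n → ℝ} (hu : AEStronglyMeasurable u volume)
    (h : eLpNorm u ∞ volume < ∞) : BM u (eLpNorm u ∞ volume).toReal := by
  refine ⟨hu, ?_⟩
  filter_upwards [ae_le_eLpNormEssSup (f := u) (μ := volume)] with x hx
  exact abs_le_toReal_of_enorm_le h (by rwa [eLpNorm_exponent_top])

lemma BM.eLpNorm_le {u : E n → ℝ} {M : ℝ} (hu : BM u M) :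
    eLpNorm u ∞ volume ≤ ENNReal.ofReal M := by
  rw [eLpNorm_exponent_top]
  exact eLpNormEssSup_le_of_ae_bound hu.bd

/-- A criterion for coincidence with the space `Λ^α`. -/
lemma coincide_of_bounds {α : ℝ} {k : ℕ} {S : Set (E n → ℝ)} {NS : (E n → ℝ) → ℝ≥0∞}
    (h₁ : ∃ C : ℝ, 0 ≤ C ∧ ∀ v ∈ S, NS v < ∞ ∧ BM v (NS v).toReal ∧
      HeatBound α k v (C * (NS v).toReal))
    (h₂ : ∃ C : ℝ, 0 ≤ C ∧ ∀ (u : E n → ℝ) (M A : ℝ), BM u M → HeatBound α k u A →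
      ∃ v ∈ S, u =ᵐ[volume] v ∧ NS v ≤ ENNReal.ofReal (C * (M + A)))
    (h₃ : ∀ v ∈ S, ∀ w ∈ S, v =ᵐ[volume] w → v = w) :
    CoincideWithEquivalentNorms (heatSpace n α k) (heatNorm α k) S NS := by
  obtain ⟨C₁, hC₁, h₁⟩ := h₁
  obtain ⟨C₂, hC₂, h₂⟩ := h₂
  have key : ∀ u ∈ heatSpace n α k, ∃ v ∈ S, u =ᵐ[volume] v ∧
      NS v ≤ ENNReal.ofReal C₂ * heatNorm α k u := by
    intro u hu
    have hu' : heatSeminorm α k u < ∞ := hu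
    have hn := (Lp.eLpNorm_ne_top u).lt_top
    obtain ⟨v, hv, huv, hle⟩ := h₂ u _ _ (bm_of_eLpNorm_lt_top (Lp.aestronglyMeasurable u) hn)
      (heatBound_of_heatSeminorm_lt_top hu')
    refine ⟨v, hv, huv, hle.trans_eq ?_⟩
    rw [ENNReal.ofReal_mul hC₂, ENNReal.ofReal_add ENNReal.toReal_nonneg ENNReal.toReal_nonneg,
      ENNReal.ofReal_toReal hn.ne, ENNReal.ofReal_toReal hu'.ne, heatNorm]
  -- Adding `1` to `C₂` makes the lower constant a genuine inverse; adding `1` to `C₁` accounts for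
  -- the `L^∞` part of the norm.
  refine ⟨fun v hv => ?_, fun u hu => ?_, (C₂.toNNReal + 1)⁻¹, C₁.toNNReal + 1, by positivity,
    by positivity, fun u hu v hv huv => ⟨?_, ?_⟩⟩
  · obtain ⟨-, hb, hH⟩ := h₁ v hv
    have hm : MemLp v ∞ volume := memLp_top_of_bound hb.aesm _ hb.bd
    exact ⟨hm, ((hH.congr_ae hm.coeFn_toLp.symm).heatSeminorm_le).trans_lt ENNReal.ofReal_lt_top⟩
  · obtain ⟨v, hv, huv, -⟩ := key u hu
    exact ⟨v, ⟨hv, huv⟩, fun w hw => h₃ w hw.1 v hv (hw.2.symm.trans huv)⟩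
  · obtain ⟨w, hw, huw, hle⟩ := key u hu
    obtain rfl : v = w := h₃ v hv w hw (huv.symm.trans huw)
    rw [ENNReal.coe_inv (by positivity), mul_comm, ← div_eq_mul_inv]
    refine ENNReal.div_le_of_le_mul (hle.trans ?_)
    rw [mul_comm]
    gcongr
    push_cast
    exact le_self_add
  · obtain ⟨hlt, hb, hH⟩ := h₁ v hv
    have e1 := (hb.congr_ae huv.symm).eLpNorm_le
    have e2 := (hH.congr_ae huv.symm).heatSeminorm_le
    rw [ENNReal.ofReal_toReal hlt.ne] at e1
    rw [ENNReal.ofReal_mul hC₁, ENNReal.ofReal_toReal hlt.ne] at e2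
    rw [heatNorm]
    push_cast
    rw [add_mul, one_mul, add_comm]
    exact add_le_add e2 e1

lemma enorm_partialDeriv_le_cNorm {m j : ℕ} (hj : j ≤ m) (v : E n → ℝ) (i : Fin j → Fin n)
    (x : E n) : ‖partialDeriv i v x‖ₑ ≤ cNorm m v := by
  have h1 : ‖partialDeriv i v x‖ₑ ≤ ⨆ (i : Fin j → Fin n) (x : E n), ‖partialDeriv i v x‖ₑ :=
    le_iSup_of_le i (le_iSup (fun x => ‖partialDeriv i v x‖ₑ) x)
  exact h1.trans (Finset.single_le_sum
    (f := fun j => ⨆ (i : Fin j → Fin n) (x : E n), ‖partialDeriv i v x‖ₑ)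
    (fun _ _ => zero_le) (Finset.mem_range.2 (Nat.lt_succ_of_le hj)))

lemma boundedDerivs_of_cNorm_le {m : ℕ} {v : E n → ℝ} (hv : ContDiff ℝ m v) {b : ℝ≥0∞} (hb : b < ∞)
    (h : cNorm m v ≤ b) : BoundedDerivs m v b.toReal :=
  ⟨hv, fun _ hj i x => abs_le_toReal_of_enorm_le hb ((enorm_partialDeriv_le_cNorm hj v i x).trans h)⟩

lemma BoundedDerivs.cNorm_le {m : ℕ} {v : E n → ℝ} {N : ℝ} (h : BoundedDerivs m v N) :
    cNorm m v ≤ ENNReal.ofReal ((m + 1) * N) := by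
  rw [ENNReal.ofReal_mul (by positivity)]
  have h1 : ∀ j ∈ Finset.range (m + 1), (⨆ (i : Fin j → Fin n) (x : E n), ‖partialDeriv i v x‖ₑ) ≤
      ENNReal.ofReal N := fun j hj => iSup_le fun i => iSup_le fun x =>
    enorm_le_of_abs_le (h.bound j (Nat.lt_succ_iff.1 (Finset.mem_range.1 hj)) i x)
  refine (Finset.sum_le_card_nsmul _ _ _ h1).trans_eq ?_
  rw [Finset.card_range, nsmul_eq_mul]
  congr 1
  rw [← Nat.cast_succ, ENNReal.ofReal_natCast]

lemma HolderBound.eHolderNorm_le {β : ℝ≥0} {w : E n → ℝ} {N : ℝ} (hN : 0 ≤ N)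
    (h : HolderBound β w N) : eHolderNorm β w ≤ ENNReal.ofReal N := by
  refine HolderWith.eHolderNorm_le (C := N.toNNReal) fun x y => ?_
  have h1 := h y (x - y)
  rw [add_sub_cancel] at h1
  rw [edist_dist, edist_dist, Real.dist_eq, dist_eq_norm,
    ENNReal.ofReal_rpow_of_nonneg (norm_nonneg _) β.coe_nonneg]
  change _ ≤ ENNReal.ofReal N * _
  rw [← ENNReal.ofReal_mul hN]
  exact ENNReal.ofReal_le_ofReal h1

lemma holderBound_of_eHolderNorm_le {β : ℝ≥0} {w : E n → ℝ} {b : ℝ≥0∞} (hb : b < ∞)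
    (h : eHolderNorm β w ≤ b) : HolderBound β w b.toReal := by
  have h1 : MemHolder β w := eHolderNorm_ne_top.1 (h.trans_lt hb).ne
  intro x y
  have h2 := h1.holderWith.dist_le (x + y) x
  rw [Real.dist_eq, dist_eq_norm, add_sub_cancel_left] at h2
  refine h2.trans (mul_le_mul_of_nonneg_right ?_ (by positivity))
  exact ENNReal.toReal_mono hb.ne h

lemma ZygmundBound.zygmundSeminorm_le {w : E n → ℝ} {N : ℝ} (h : ZygmundBound 1 w N) :
    zygmundSeminorm w ≤ ENNReal.ofReal N := by
  refine iSup_le fun x => iSup_le fun y => iSup_le fun hy => ?_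
  have h1 := h x y
  rw [Real.rpow_one] at h1
  refine ENNReal.div_le_of_le_mul ?_
  have h2 := enorm_le_of_abs_le h1
  rwa [ENNReal.ofReal_mul' (norm_nonneg _), ofReal_norm] at h2

lemma zygmundBound_of_zygmundSeminorm_le {w : E n → ℝ} {b : ℝ≥0∞} (hb : b < ∞)
    (h : zygmundSeminorm w ≤ b) : ZygmundBound 1 w b.toReal := by
  intro x y
  rw [Real.rpow_one]
  rcases eq_or_ne y 0 with rfl | hy
  · simp only [secondDiff, add_zero, sub_zero, norm_zero, mul_zero]
    rw [← two_mul, sub_self, abs_zero]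
  have h1 : ‖secondDiff w y x‖ₑ / ‖y‖ₑ ≤ b :=
    (le_iSup_of_le x (le_iSup_of_le y (le_iSup_of_le hy le_rfl)) : _ ≤ zygmundSeminorm w).trans h
  have h2 : ‖secondDiff w y x‖ₑ ≤ b * ‖y‖ₑ :=
    (ENNReal.div_le_iff (by simpa using hy) (by simp)).1 h1
  have h3 := abs_le_toReal_of_enorm_le (ENNReal.mul_lt_top hb (by simp)) h2
  rwa [ENNReal.toReal_mul, toReal_enorm] at h3

/-! ### The three cases -/

lemma heatSpace_eq_holderSpace (n m : ℕ) {β : ℝ≥0} (hβ : 0 < β) (hβ1 : β < 1) {k : ℕ}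
    (hk : (m + (β : ℝ)) / 2 < k) :
    CoincideWithEquivalentNorms (heatSpace n (m + β) k) (heatNorm (m + β) k) (holderSpace n m β)
      (holderNorm m β) := by
  have hβ' : (0 : ℝ) < β := hβ
  have hβ1' : (β : ℝ) < 1 := hβ1
  refine coincide_of_bounds ?_ ?_ ?_
  · obtain ⟨C, hC, h⟩ := BoundedDerivs.heatBound n m hβ' hβ1'.le hk
    -- The `2` comes from bounding a second difference by two first differences.
    refine ⟨C * 2, by positivity, fun v hv => ?_⟩
    have hb := boundedDerivs_of_cNorm_le hv.1 hv.2 le_self_add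
    refine ⟨hv.2, hb.bm, ?_⟩
    rw [mul_assoc]
    refine h v _ (hb.mono (by linarith [hb.nonneg])) fun i => ?_
    exact (holderBound_of_eHolderNorm_le hv.2
      ((le_iSup (fun i => eHolderNorm β (partialDeriv i v)) i).trans le_add_self)).zygmund
  · obtain ⟨C, hC, h⟩ := HeatBound.exists_boundedDerivs n m hβ' hβ1'.le (k := k)
    -- There are `m + 1` orders of derivatives in `cNorm m` and one Hölder seminorm.
    refine ⟨(m + 2) * C, by positivity, fun u M A hu hA => ?_⟩
    obtain ⟨v, huv, hb, hz⟩ := h u M A hu hA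
    have hle : holderNorm m β v ≤ ENNReal.ofReal ((m + 2) * C * (M + A)) := by
      have h1 := hb.cNorm_le
      have h2 : (⨆ i : Fin m → Fin n, eHolderNorm β (partialDeriv i v)) ≤
          ENNReal.ofReal (C * (M + A)) :=
        iSup_le fun i => ((hz i).2 hβ1').eHolderNorm_le hb.nonneg
      refine (add_le_add h1 h2).trans_eq ?_
      rw [← ENNReal.ofReal_add (mul_nonneg (by positivity) hb.nonneg) hb.nonneg]
      congr 1
      ring
    exact ⟨v, ⟨hb.contDiff, hle.trans_lt ENNReal.ofReal_lt_top⟩, huv, hle⟩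
  · exact fun v hv w hw hvw =>
      (hv.1.continuous.ae_eq_iff_eq volume hw.1.continuous).1 hvw

/-- Members of `zygmundOne` are not assumed continuous, so uniqueness needs this. For almost every
`y` both `w (x ± y)` vanish, leaving `2|w x| ≤ N|y|`; this closed condition holds on a dense set,
hence at `y = 0`. -/
lemma ZygmundBound.eq_zero {w : E n → ℝ} {N : ℝ} (h : ZygmundBound 1 w N)
    (h0 : w =ᵐ[volume] 0) (x : E n) : w x = 0 := by
  have h1 : ∀ᵐ y : E n, w (x + y) = 0 :=
    (measurePreserving_add_left volume x).quasiMeasurePreserving.ae h0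
  have h2 : ∀ᵐ y : E n, w (x - y) = 0 := (quasiMeasurePreserving_sub_left volume x).ae h0
  have h3 : ∀ᵐ y : E n, 2 * |w x| ≤ N * ‖y‖ := by
    filter_upwards [h1, h2] with y hy1 hy2
    have := h x y
    rw [secondDiff, hy1, hy2, add_zero, zero_sub, abs_neg, abs_mul, abs_two, Real.rpow_one] at this
    exact this
  have h4 : Dense {y : E n | 2 * |w x| ≤ N * ‖y‖} := Measure.dense_of_ae h3
  have h5 : IsClosed {y : E n | 2 * |w x| ≤ N * ‖y‖} :=
    isClosed_le continuous_const (by fun_prop)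
  have h6 : (0 : E n) ∈ closure {y : E n | 2 * |w x| ≤ N * ‖y‖} := h4 0
  rw [h5.closure_eq, Set.mem_ofPred_eq, norm_zero, mul_zero] at h6
  exact abs_nonpos_iff.1 (by linarith)

lemma heatSpace_eq_zygmundSpace_one (n : ℕ) {k : ℕ} (hk : (1 : ℝ) / 2 < k) :
    CoincideWithEquivalentNorms (heatSpace n 1 k) (heatNorm 1 k) (zygmundSpace n 1)
      (zygmundNorm 1) := by
  have hS : zygmundSpace n 1 = zygmundOne n := by simp [zygmundSpace]
  have hN : ∀ v : E n → ℝ, zygmundNorm 1 v = eLpNorm v ∞ volume + zygmundSeminorm v := fun v => by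
    simp [zygmundNorm]
  rw [hS]
  refine coincide_of_bounds ?_ ?_ ?_
  · obtain ⟨C, hC, h⟩ := ZygmundBound.heatBound_order n one_pos le_rfl hk
    refine ⟨C, hC, fun v hv => ?_⟩
    have hlt : zygmundNorm 1 v < ∞ := by
      rw [hN]
      exact ENNReal.add_lt_top.2 ⟨hv.1.2, hv.2⟩
    have hb : BM v (zygmundNorm 1 v).toReal := (bm_of_eLpNorm_lt_top hv.1.1 hv.1.2).mono
      (ENNReal.toReal_mono hlt.ne (by rw [hN]; exact le_self_add))
    exact ⟨hlt, hb, h v _ _ hb ENNReal.toReal_nonneg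
      (zygmundBound_of_zygmundSeminorm_le hlt (by rw [hN]; exact le_add_self))⟩
  · obtain ⟨C, hC, h⟩ := HeatBound.exists_boundedDerivs n 0 one_pos le_rfl (k := k)
    refine ⟨2 * C, by positivity, fun u M A hu hA => ?_⟩
    obtain ⟨v, huv, hb, hz⟩ := h u M A hu (by rwa [Nat.cast_zero, zero_add])
    have hz := (hz Fin.elim0).1
    rw [partialDeriv_zero] at hz
    have h1 := hb.bm.eLpNorm_le
    have h2 := hz.zygmundSeminorm_le
    refine ⟨v, ⟨⟨hb.bm.aesm, h1.trans_lt ENNReal.ofReal_lt_top⟩,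
      h2.trans_lt ENNReal.ofReal_lt_top⟩, huv, ?_⟩
    rw [hN]
    refine (add_le_add h1 h2).trans_eq ?_
    rw [← ENNReal.ofReal_add hb.nonneg hb.nonneg]
    congr 1
    ring
  · intro v hv w hw hvw
    have h1 := zygmundBound_of_zygmundSeminorm_le hv.2 le_rfl
    have h2 := zygmundBound_of_zygmundSeminorm_le hw.2 le_rfl
    have h3 : ZygmundBound 1 (v - w) ((zygmundSeminorm v).toReal + (zygmundSeminorm w).toReal) := by
      intro x y
      have : secondDiff (v - w) y x = secondDiff v y x - secondDiff w y x := by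
        simp only [secondDiff, Pi.sub_apply]
        ring
      rw [this, add_mul]
      exact (abs_sub _ _).trans (add_le_add (h1 x y) (h2 x y))
    have h4 : v - w =ᵐ[volume] 0 := by
      filter_upwards [hvw] with x hx
      simp [hx]
    funext x
    exact sub_eq_zero.1 (h3.eq_zero h4 x)

lemma heatSpace_eq_zygmundSpace_add_two (n l : ℕ) {k : ℕ} (hk : ((l + 2 : ℕ) : ℝ) / 2 < k) :
    CoincideWithEquivalentNorms (heatSpace n (l + 2 : ℕ) k) (heatNorm (l + 2 : ℕ) k)
      (zygmundSpace n (l + 2)) (zygmundNorm (l + 2)) := by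
  have hS : ∀ v : E n → ℝ, v ∈ zygmundSpace n (l + 2) ↔ ContDiff ℝ (l + 1 : ℕ) v ∧
      cNorm (l + 1) v < ∞ ∧ ∀ i : Fin (l + 1) → Fin n, partialDeriv i v ∈ zygmundOne n := fun v => by
    simp [zygmundSpace]
  have hN : ∀ v : E n → ℝ, zygmundNorm (l + 2) v = cNorm (l + 1) v +
      ⨆ i : Fin (l + 1) → Fin n, zygmundSeminorm (partialDeriv i v) := fun v => by
    simp [zygmundNorm]
  -- An integer exponent is split as `m + β` with `m = l + 1` and `β = 1`, not with a zero
  -- fractional part.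
  have hα : ((l + 2 : ℕ) : ℝ) = (l + 1 : ℕ) + 1 := by push_cast; ring
  rw [hα] at hk ⊢
  refine coincide_of_bounds ?_ ?_ ?_
  · obtain ⟨C, hC, h⟩ := BoundedDerivs.heatBound n (l + 1) one_pos le_rfl hk
    refine ⟨C, by positivity, fun v hv => ?_⟩
    obtain ⟨hv1, hv2, hv3⟩ := (hS v).1 hv
    have hlt : zygmundNorm (l + 2) v < ∞ := by
      rw [hN]
      refine ENNReal.add_lt_top.2 ⟨hv2, ?_⟩
      -- Membership gives finiteness of each seminorm separately; there are finitely many indices,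
      -- so the supremum is finite too.
      have : (⨆ i : Fin (l + 1) → Fin n, zygmundSeminorm (partialDeriv i v)) ≤
          ∑ i : Fin (l + 1) → Fin n, zygmundSeminorm (partialDeriv i v) :=
        iSup_le fun i => Finset.single_le_sum
          (f := fun i : Fin (l + 1) → Fin n => zygmundSeminorm (partialDeriv i v))
          (fun _ _ => zero_le) (Finset.mem_univ i)
      exact this.trans_lt (ENNReal.sum_lt_top.2 fun i _ => (hv3 i).2)
    have hb := boundedDerivs_of_cNorm_le hv1 hlt (by rw [hN]; exact le_self_add)
    refine ⟨hlt, hb.bm, h v _ hb fun i => zygmundBound_of_zygmundSeminorm_le hlt ?_⟩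
    rw [hN]
    exact (le_iSup (fun i => zygmundSeminorm (partialDeriv i v)) i).trans le_add_self
  · obtain ⟨C, hC, h⟩ := HeatBound.exists_boundedDerivs n (l + 1) one_pos le_rfl (k := k)
    refine ⟨((l + 1 : ℕ) + 2) * C, by positivity, fun u M A hu hA => ?_⟩
    obtain ⟨v, huv, hb, hz⟩ := h u M A hu hA
    have h1 := hb.cNorm_le
    have h2 : ∀ i : Fin (l + 1) → Fin n, zygmundSeminorm (partialDeriv i v) ≤
        ENNReal.ofReal (C * (M + A)) := fun i => (hz i).1.zygmundSeminorm_le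
    refine ⟨v, (hS v).2 ⟨hb.contDiff, h1.trans_lt ENNReal.ofReal_lt_top, fun i =>
      ⟨?_, (h2 i).trans_lt ENNReal.ofReal_lt_top⟩⟩, huv, ?_⟩
    · have hc : Continuous (partialDeriv i v) := by
        have := hb.contDiff.continuous_iteratedFDeriv (m := l + 1) le_rfl
        unfold partialDeriv
        fun_prop
      exact memLp_top_of_bound hc.aestronglyMeasurable _ (ae_of_all _ (hb.bound _ le_rfl i))
    · rw [hN]
      refine (add_le_add h1 (iSup_le h2)).trans_eq ?_
      rw [← ENNReal.ofReal_add (mul_nonneg (by positivity) hb.nonneg) hb.nonneg]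
      congr 1
      ring
  · exact fun v hv w hw hvw => (((hS v).1 hv).1.continuous.ae_eq_iff_eq volume
      ((hS w).1 hw).1.continuous).1 hvw

end HeatHolder

end

theorem mainTheorem9 (n : ℕ) (hn : 1 ≤ n) (α : ℝ) (hα : 0 < α)
    (k : ℕ) (hk : ⌊α / 2⌋₊ + 1 ≤ k) :
    ((∀ l : ℕ, α ≠ l) →
      HeatHolder.CoincideWithEquivalentNorms
        (HeatHolder.heatSpace n α k) (HeatHolder.heatNorm α k)
        (HeatHolder.holderSpace n ⌊α⌋₊ (α - ⌊α⌋₊).toNNReal)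
        (HeatHolder.holderNorm ⌊α⌋₊ (α - ⌊α⌋₊).toNNReal)) ∧
    (∀ l : ℕ, α = l →
      HeatHolder.CoincideWithEquivalentNorms
        (HeatHolder.heatSpace n α k) (HeatHolder.heatNorm α k)
        (HeatHolder.zygmundSpace n l) (HeatHolder.zygmundNorm l)) := by
  -- The condition on `k` serves only as `α/2 < k`, the threshold in `HeatBound.change`.
  have hk' : α / 2 < k := (Nat.lt_floor_add_one (α / 2)).trans_le (by exact_mod_cast hk)
  refine ⟨fun hl => ?_, fun l hl => ?_⟩
  · have h0 : 0 < α - ⌊α⌋₊ :=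
      sub_pos.2 (lt_of_le_of_ne (Nat.floor_le hα.le) fun h => hl _ h.symm)
    have h1 : α - ⌊α⌋₊ < 1 := by linarith [Nat.lt_floor_add_one α]
    have h2 : (⌊α⌋₊ : ℝ) + ((α - ⌊α⌋₊).toNNReal : ℝ) = α := by
      rw [Real.coe_toNNReal _ h0.le]
      ring
    have := HeatHolder.heatSpace_eq_holderSpace n ⌊α⌋₊ (β := (α - ⌊α⌋₊).toNNReal) (k := k)
      (Real.toNNReal_pos.2 h0) (by rwa [Real.toNNReal_lt_one]) (by rwa [h2])
    rwa [h2] at this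
  · subst hl
    match l with
    | 0 => simp at hα
    | 1 =>
      rw [Nat.cast_one] at *
      exact HeatHolder.heatSpace_eq_zygmundSpace_one n hk'
    | l + 2 => exact HeatHolder.heatSpace_eq_zygmundSpace_add_two n l hk'
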